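/- Let $d$ be an odd positive integer and $\ell=\sqrt{2\pi/d}$. For $\mathbf a=(\mathbf a_X,\mathbf a_Z)$ and $\mathbf b=(\mathbf b_X,\mathbf b_Z)$ in $\mathbb R^{2n}$ put $[\mathbf a,\mathbf b]=\mathbf a_X\cdot\mathbf b_Z-\mathbf a_Z\cdot\mathbf b_X$, and let $\hat T_{\mathbf a}=e^{i\pi\mathbf a_X\cdot\mathbf a_Z/d}\,e^{-i\ell\mathbf a_X\cdot\hat{\mathbf p}}\,e^{i\ell\mathbf a_Z\cdot\hat{\mathbf q}}$ on $L^2(\mathbb R^n)$, where $(e^{-i\mathbf s\cdot\hat{\mathbf p}}\psi)(\mathbf x)=\psi(\mathbf x-\mathbf s)$ and $(e^{i\mathbf t\cdot\hat{\mathbf q}}\psi)(\mathbf x)=e^{i\mathbf t\cdot\mathbf x}\psi(\mathbf x)$. The phase-point operator $$\hat A_{\boldsymbol\eta}=\frac1{(2\pi)^n}\sum_{\mathbf a\in\mathbb Z^{2n}}e^{i\ell[\mathbf a,\boldsymbol\eta]+i\pi\mathbf a_X\cdot\mathbf a_Z}\,\hat T_{\mathbf a}$$ is a generalised operator, given by its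 matrix elements $\langle f,\hat A_{\boldsymbol\eta}g\rangle=\frac1{(2\pi)^n}\sum_{\mathbf a}e^{i\ell[\mathbf a,\boldsymbol\eta]+i\pi\mathbf a_X\cdot\mathbf a_Z}\langle f,\hat T_{\mathbf a}g\rangle$ for all pairs $f,g\in L^2(\mathbb R^n)$ for which the series converges absolutely; write $(f,g)\in\mathcal D_n$ for such pairs. For a state (density operator) $\hat\rho$ on $L^2(\mathbb R^n)$ the Zak-Gross Wigner function is $$W_{\hat\rho}(\boldsymbol\eta)=\operatorname{Tr}(\hat\rho\hat A_{\boldsymbol\eta})=\frac1{(2\pi)^n}\sum_{\mathbf a\in\mathbb Z^{2n}}e^{i\ell[\mathbf a,\boldsymbol\eta]+i\pi\mathbf a_X\cdot\mathbf a_Z}\operatorname{Tr}(\hat\rho\hat T_{\mathbf a}),\qquad\boldsymbol\eta\in[0,d\ell)^{2n}.$$ It is the sum of this series if the series converges absolutely (the formula then makes sense for every $\boldsymbol\eta\in\mathbb R^{2n}$), and otherwise the integrable function on $[0,d\ell)^{2n}$, unique up to null sets, whose Fourier series this is. Its negativity (negative volume) is $\mathcal M_{\hat\rho}=\int_{[0,d\ell)^{2n}}|W_{\hat\rho}(\boldsymbol\eta)|\,d\boldsymbol\eta$.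 Let $n=m+m'$, identify $L^2(\mathbb R^m)\otimes L^2(\mathbb R^{m'})$ with $L^2(\mathbb R^n)$, and for $\boldsymbol\eta\in\mathbb R^{2n}$ let $\boldsymbol\eta^{(1)}\in\mathbb R^{2m}$ and $\boldsymbol\eta^{(2)}\in\mathbb R^{2m'}$ be its parts that belong to the first $m$ and to the last $m'$ modes. Then: 1. $\hat A_{\boldsymbol\eta}=\hat A_{\boldsymbol\eta^{(1)}}\otimes\hat A_{\boldsymbol\eta^{(2)}}$ for all $\boldsymbol\eta$. That is: for any number of modes all pairs of Schwartz functions have matrix elements; if $(f_1,g_1)\in\mathcal D_m$ and $(f_2,g_2)\in\mathcal D_{m'}$, then $(f_1\otimes f_2,g_1\otimes g_2)\in\mathcal D_n$ and $$\langle f_1\otimes f_2,\hat A_{\boldsymbol\eta}(g_1\otimes g_2)\rangle=\langle f_1,\hat A_{\boldsymbol\eta^{(1)}}g_1\rangle\,\langle f_2,\hat A_{\boldsymbol\eta^{(2)}}g_2\rangle;$$ and for every $(F,G)\in\mathcal D_n$, $\langle F,\hat A_{\boldsymbol\eta}G\rangle$ is the limit of $\langle F,(\hat A^{S_1}_{\boldsymbol\eta^{(1)}}\otimes\hat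 A^{S_2}_{\boldsymbol\eta^{(2)}})G\rangle$ as the finite sets $S_1\subset\mathbb Z^{2m}$, $S_2\subset\mathbb Z^{2m'}$ increase, where $\hat A^{S}_{\boldsymbol\eta}$ is the partial sum of the series of $\hat A_{\boldsymbol\eta}$ over $\mathbf a\in S$. 2. For all states $\hat\rho$ on $m$ modes and $\hat\sigma$ on $m'$ modes, $$W_{\hat\rho\otimes\hat\sigma}(\boldsymbol\eta)=W_{\hat\rho}(\boldsymbol\eta^{(1)})\,W_{\hat\sigma}(\boldsymbol\eta^{(2)})$$ for almost every $\boldsymbol\eta\in[0,d\ell)^{2n}$; if the series of $W_{\hat\rho}$ and $W_{\hat\sigma}$ converge absolutely, then so does that of $W_{\hat\rho\otimes\hat\sigma}$, and the identity holds for every $\boldsymbol\eta\in\mathbb R^{2n}$. 3. The negativity is multiplicative: $\mathcal M_{\hat\rho\otimes\hat\sigma}=\mathcal M_{\hat\rho}\,\mathcal M_{\hat\sigma}$ for all states $\hat\rho$ on $m$ modes and $\hat\sigma$ on $m'$ modes. -/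

import Mathlib

open MeasureTheory Filter Topology
open scoped InnerProductSpace TensorProduct SchwartzMap

noncomputable section

namespace ZakGross

/-! ### Configuration space, phase space and Hilbert space of `n` modes -/

/-- The Hilbert space `L²(ℝⁿ)` of `n` bosonic modes, in the position representation. -/
abbrev Hilb (n : ℕ) : Type := Lp ℂ 2 (volume : Measure (Fin n → ℝ))

/-- Pairs `a = (a_X, a_Z)` of vectors of length `n`, i.e. vectors of length `2n`. -/
abbrev Phase (R : Type) (n : ℕ) : Type := (Fin n → R) × (Fin n → R)

/-- The symplectic form `[a, b] = a_X · b_Z - a_Z · b_X`. -/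
def symp {n : ℕ} (a b : Phase ℝ n) : ℝ := a.1 ⬝ᵥ b.2 - a.2 ⬝ᵥ b.1

/-- An integer vector, seen as a real vector. -/
def toReal {n : ℕ} (a : Phase ℤ n) : Phase ℝ n := (fun i => (a.1 i : ℝ), fun i => (a.2 i : ℝ))

/-- The first `m` entries of a vector of length `m + k`. -/
def left {R : Type} {m k : ℕ} (x : Fin (m + k) → R) : Fin m → R := fun i => x (Fin.castAdd k i)

/-- The last `k` entries of a vector of length `m + k`. -/
def right {R : Type} {m k : ℕ} (x : Fin (m + k) → R) : Fin k → R := fun j => x (Fin.natAdd m j)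

/-- The part `η⁽¹⁾` of a phase-space vector that belongs to the first `m` of `m + k` modes. -/
def fstModes {R : Type} {m k : ℕ} (η : Phase R (m + k)) : Phase R m := (left η.1, left η.2)

/-- The part `η⁽²⁾` of a phase-space vector that belongs to the last `k` of `m + k` modes. -/
def sndModes {R : Type} {m k : ℕ} (η : Phase R (m + k)) : Phase R k := (right η.1, right η.2)

/-- The lattice constant `ℓ = √(2π/d)`. -/
def ell (d : ℕ) : ℝ := Real.sqrt (2 * Real.pi / d)

/-- The domain `[0, dℓ)^{2n}` of the Zak-Gross Wigner function. -/
def cell (d n : ℕ) : Set (Phase ℝ n) :=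
  {η | (∀ i, η.1 i ∈ Set.Ico 0 (d * ell d)) ∧ ∀ i, η.2 i ∈ Set.Ico 0 (d * ell d)}

/-! ### Displacement operators -/

/-- `exp(-i s · p̂)`, which acts on wave functions by `ψ ↦ ψ(· - s)`. -/
def translation {n : ℕ} (s : Fin n → ℝ) : Hilb n →L[ℂ] Hilb n :=
  (Lp.compMeasurePreservingₗᵢ ℂ (fun x : Fin n → ℝ => x - s)
    (measurePreserving_sub_right volume s)).toContinuousLinearMap

theorem memLp_modulation {n : ℕ} (t : Fin n → ℝ) (f : Hilb n) :
    MemLp (fun x : Fin n → ℝ => Complex.exp (Complex.I * ((t ⬝ᵥ x : ℝ) : ℂ)) * f x) 2 volume := by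
  refine (Lp.memLp f).of_le_mul (c := 1) ?_ ?_
  · refine AEStronglyMeasurable.mul ?_ (Lp.aestronglyMeasurable f)
    refine Continuous.aestronglyMeasurable ?_
    unfold dotProduct
    fun_prop
  · refine Eventually.of_forall fun x => ?_
    rw [norm_mul, mul_comm Complex.I, Complex.norm_exp_ofReal_mul_I]

/-- `exp(i t · q̂)`, which acts on wave functions by multiplication with `exp(i t · x)`. -/
def modulation {n : ℕ} (t : Fin n → ℝ) : Hilb n →L[ℂ] Hilb n :=
  LinearMap.mkContinuous
    { toFun := fun f => (memLp_modulation t f).toLp _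
      map_add' := fun f g => by
        rw [← MemLp.toLp_add, MemLp.toLp_eq_toLp_iff]
        filter_upwards [Lp.coeFn_add f g] with x hx
        simp only [hx, Pi.add_apply, mul_add]
      map_smul' := fun c f => by
        rw [RingHom.id_apply, ← MemLp.toLp_const_smul, MemLp.toLp_eq_toLp_iff]
        filter_upwards [Lp.coeFn_smul c f] with x hx
        simp only [hx, Pi.smul_apply, smul_eq_mul]
        ring }
    1 fun f => by
      rw [one_mul]
      refine Lp.norm_le_norm_of_ae_le ?_
      filter_upwards [(memLp_modulation t f).coeFn_toLp] with x hx
      simp only [LinearMap.coe_mk, AddHom.coe_mk]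
      rw [hx, norm_mul, mul_comm Complex.I, Complex.norm_exp_ofReal_mul_I, one_mul]

/-- The operators `T_a = exp(iπ a_X·a_Z/d) exp(-iℓ a_X·p̂) exp(iℓ a_Z·q̂)`, i.e. the displacement
operators `D(-ℓa)`. -/
def T {n : ℕ} (d : ℕ) (a : Phase ℝ n) : Hilb n →L[ℂ] Hilb n :=
  Complex.exp (Complex.I * ((Real.pi * (a.1 ⬝ᵥ a.2) / d : ℝ) : ℂ)) •
    (translation (ell d • a.1) ∘L modulation (ell d • a.2))

/-! ### The phase-point operators -/

/-- The coefficient `exp(iℓ[a, η] + iπ a_X · a_Z)`. -/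
def phaseCoeff {n : ℕ} (d : ℕ) (η : Phase ℝ n) (a : Phase ℤ n) : ℂ :=
  Complex.exp (Complex.I *
    ((ell d * symp (toReal a) η + Real.pi * ((toReal a).1 ⬝ᵥ (toReal a).2) : ℝ) : ℂ))

/-- The finite truncation `(2π)⁻ⁿ ∑_{a ∈ S} exp(iℓ[a, η] + iπ a_X · a_Z) T_a` of the phase-point
operator, a bounded operator. -/
def phasePointTrunc {n : ℕ} (d : ℕ) (η : Phase ℝ n) (S : Finset (Phase ℤ n)) :
    Hilb n →L[ℂ] Hilb n :=
  (1 / (2 * (Real.pi : ℂ)) ^ n) • ∑ a ∈ S, phaseCoeff d η a • T d (toReal a)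

/-- The pairs of vectors between which the phase-point operators have matrix elements: the series
that defines the matrix element converges absolutely. -/
def InFormDomain {n : ℕ} (d : ℕ) (f g : Hilb n) : Prop :=
  Summable fun a : Phase ℤ n => ⟪f, T d (toReal a) g⟫_ℂ

/-- The phase-point operator
`A_η = (2π)⁻ⁿ ∑_{a ∈ ℤ²ⁿ} exp(iℓ[a, η] + iπ a_X · a_Z) T_a`.
The series does not converge to an operator on `L²(ℝⁿ)`: like the ideal GKP states it is a
generalised operator, given by its matrix elements `⟨f, A_η g⟩`. -/
def phasePoint {n : ℕ} (d : ℕ) (η : Phase ℝ n) (f g : Hilb n) : ℂ :=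
  1 / (2 * (Real.pi : ℂ)) ^ n *
    ∑' a : Phase ℤ n, phaseCoeff d η a * ⟪f, T d (toReal a) g⟫_ℂ

/-! ### Tensor products -/

theorem measurePreserving_split (m k : ℕ) :
    MeasurePreserving (fun x : Fin (m + k) → ℝ => ((left x, right x) : (Fin m → ℝ) × (Fin k → ℝ)))
      volume volume := by
  have h := (volume_measurePreserving_sumPiEquivProdPi (fun _ : Fin m ⊕ Fin k => ℝ)).comp
    (volume_measurePreserving_piCongrLeft (fun _ : Fin m ⊕ Fin k => ℝ) finSumFinEquiv.symm)
  convert h using 1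
  funext x
  refine Prod.ext (funext fun i => ?_) (funext fun j => ?_)
  · have := MeasurableEquiv.piCongrLeft_apply_apply (β := fun _ : Fin m ⊕ Fin k => ℝ)
      finSumFinEquiv.symm x (Fin.castAdd k i)
    simp only [finSumFinEquiv_symm_apply_castAdd] at this
    exact this.symm
  · have := MeasurableEquiv.piCongrLeft_apply_apply (β := fun _ : Fin m ⊕ Fin k => ℝ)
      finSumFinEquiv.symm x (Fin.natAdd m j)
    simp only [finSumFinEquiv_symm_apply_natAdd] at this
    exact this.symm

theorem memLp_tensor {m k : ℕ} (f : Hilb m) (g : Hilb k) :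
    MemLp (fun x : Fin (m + k) → ℝ => f (left x) * g (right x)) 2 volume := by
  have h : MemLp (fun p : (Fin m → ℝ) × (Fin k → ℝ) => f p.1 * g p.2) 2 volume := by
    have hm : AEStronglyMeasurable (fun p : (Fin m → ℝ) × (Fin k → ℝ) => f p.1 * g p.2)
        volume := (Lp.aestronglyMeasurable f).comp_fst.mul (Lp.aestronglyMeasurable g).comp_snd
    rw [memLp_two_iff_integrable_sq_norm hm]
    have := ((memLp_two_iff_integrable_sq_norm (Lp.aestronglyMeasurable f)).1
      (Lp.memLp f)).mul_prod
      ((memLp_two_iff_integrable_sq_norm (Lp.aestronglyMeasurable g)).1 (Lp.memLp g))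
    rw [Measure.volume_eq_prod]
    simpa only [norm_mul, mul_pow] using this
  exact h.comp_measurePreserving (measurePreserving_split m k)

/-- The product vector `f ⊗ g`, i.e. the wave function `(x, y) ↦ f(x) g(y)`. -/
def tensorVec {m k : ℕ} (f : Hilb m) (g : Hilb k) : Hilb (m + k) := (memLp_tensor f g).toLp _

theorem coeFn_tensorVec {m k : ℕ} (f : Hilb m) (g : Hilb k) :
    tensorVec f g =ᵐ[volume] fun x => f (left x) * g (right x) :=
  (memLp_tensor f g).coeFn_toLp

theorem quasi_left (m k : ℕ) : Measure.QuasiMeasurePreserving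
    (left : (Fin (m + k) → ℝ) → (Fin m → ℝ)) volume volume :=
  Measure.quasiMeasurePreserving_fst.comp (measurePreserving_split m k).quasiMeasurePreserving

theorem quasi_right (m k : ℕ) : Measure.QuasiMeasurePreserving
    (right : (Fin (m + k) → ℝ) → (Fin k → ℝ)) volume volume :=
  Measure.quasiMeasurePreserving_snd.comp (measurePreserving_split m k).quasiMeasurePreserving

/-- The bilinear map `(f, g) ↦ f ⊗ g`. -/
def tensorBilin (m k : ℕ) : Hilb m →ₗ[ℂ] Hilb k →ₗ[ℂ] Hilb (m + k) :=
  LinearMap.mk₂ ℂ tensorVec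
    (fun f f' g => by
      refine Lp.ext ?_
      filter_upwards [coeFn_tensorVec (f + f') g, coeFn_tensorVec f g, coeFn_tensorVec f' g,
        Lp.coeFn_add (tensorVec f g) (tensorVec f' g),
        (quasi_left m k).ae (Lp.coeFn_add f f')] with x h1 h2 h3 h4 h5
      simp only [h1, h4, h5, Pi.add_apply, h2, h3, add_mul])
    (fun c f g => by
      refine Lp.ext ?_
      filter_upwards [coeFn_tensorVec (c • f) g, coeFn_tensorVec f g,
        Lp.coeFn_smul c (tensorVec f g), (quasi_left m k).ae (Lp.coeFn_smul c f)] with x h1 h2 h4 h5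
      simp only [h1, h4, h5, Pi.smul_apply, h2, smul_eq_mul, mul_assoc])
    (fun f g g' => by
      refine Lp.ext ?_
      filter_upwards [coeFn_tensorVec f (g + g'), coeFn_tensorVec f g, coeFn_tensorVec f g',
        Lp.coeFn_add (tensorVec f g) (tensorVec f g'),
        (quasi_right m k).ae (Lp.coeFn_add g g')] with x h1 h2 h3 h4 h5
      simp only [h1, h4, h5, Pi.add_apply, h2, h3, mul_add])
    (fun c f g => by
      refine Lp.ext ?_
      filter_upwards [coeFn_tensorVec f (c • g), coeFn_tensorVec f g,
        Lp.coeFn_smul c (tensorVec f g),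
        (quasi_right m k).ae (Lp.coeFn_smul c g)] with x h1 h2 h4 h5
      simp only [h1, h4, h5, Pi.smul_apply, h2, smul_eq_mul]
      ring)

theorem inner_tensorVec {m k : ℕ} (f f' : Hilb m) (g g' : Hilb k) :
    ⟪tensorVec f g, tensorVec f' g'⟫_ℂ = ⟪f, f'⟫_ℂ * ⟪g, g'⟫_ℂ := by
  let F : (Fin m → ℝ) × (Fin k → ℝ) → ℂ := fun p => ⟪f p.1, f' p.1⟫_ℂ * ⟪g p.2, g' p.2⟫_ℂ
  have hm : AEStronglyMeasurable F volume :=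
    (AEStronglyMeasurable.inner (𝕜 := ℂ) (Lp.aestronglyMeasurable f)
      (Lp.aestronglyMeasurable f')).comp_fst.mul
    (AEStronglyMeasurable.inner (𝕜 := ℂ) (Lp.aestronglyMeasurable g)
      (Lp.aestronglyMeasurable g')).comp_snd
  have h : ∫ x : Fin (m + k) → ℝ, ⟪tensorVec f g x, tensorVec f' g' x⟫_ℂ =
      ∫ x : Fin (m + k) → ℝ, F (left x, right x) := by
    refine integral_congr_ae ?_
    filter_upwards [coeFn_tensorVec f g, coeFn_tensorVec f' g'] with x h1 h2
    simp only [F, h1, h2, RCLike.inner_apply, map_mul]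
    ring
  have h' : ∫ p, F p = ∫ x : Fin (m + k) → ℝ, F (left x, right x) := by
    have e := (measurePreserving_split m k).map_eq
    have := integral_map (measurePreserving_split m k).measurable.aemeasurable (f := F)
      (by rwa [e])
    rwa [e] at this
  rw [L2.inner_def, L2.inner_def, L2.inner_def, h, ← h', Measure.volume_eq_prod]
  exact integral_prod_mul (fun x => ⟪f x, f' x⟫_ℂ) (fun y => ⟪g y, g' y⟫_ℂ)

/-- The canonical map of the algebraic tensor product `L²(ℝᵐ) ⊗ L²(ℝᵏ)` into `L²(ℝᵐ⁺ᵏ)`. -/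
def tensorMap (m k : ℕ) : Hilb m ⊗[ℂ] Hilb k →ₗ[ℂ] Hilb (m + k) :=
  TensorProduct.lift (tensorBilin m k)

theorem tensorMap_tmul {m k : ℕ} (f : Hilb m) (g : Hilb k) :
    tensorMap m k (f ⊗ₜ g) = tensorVec f g := rfl

theorem inner_tensorMap {m k : ℕ} (u v : Hilb m ⊗[ℂ] Hilb k) :
    ⟪tensorMap m k u, tensorMap m k v⟫_ℂ = ⟪u, v⟫_ℂ := by
  induction u using TensorProduct.induction_on with
  | zero => simp
  | add u u' hu hu' => rw [map_add, inner_add_left, inner_add_left, hu, hu']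
  | tmul f g =>
    induction v using TensorProduct.induction_on with
    | zero => simp
    | add v v' hv hv' => rw [map_add, inner_add_right, inner_add_right, hv, hv']
    | tmul f' g' =>
      rw [tensorMap_tmul, tensorMap_tmul, inner_tensorVec, TensorProduct.inner_tmul]

theorem norm_tensorMap {m k : ℕ} (u : Hilb m ⊗[ℂ] Hilb k) : ‖tensorMap m k u‖ = ‖u‖ := by
  rw [@norm_eq_sqrt_re_inner ℂ, @norm_eq_sqrt_re_inner ℂ, inner_tensorMap]

theorem exists_bound_map {m k : ℕ} (A : Hilb m →L[ℂ] Hilb m) (B : Hilb k →L[ℂ] Hilb k) :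
    ∃ C : ℝ, ∀ u : Hilb m ⊗[ℂ] Hilb k,
      ‖TensorProduct.map (A : Hilb m →ₗ[ℂ] Hilb m) (B : Hilb k →ₗ[ℂ] Hilb k) u‖ ≤ C * ‖u‖ := by
  have hA : A ∈ Submodule.span ℂ (unitary (Hilb m →L[ℂ] Hilb m) : Set _) := by
    rw [CStarAlgebra.span_unitary]; trivial
  have hB : B ∈ Submodule.span ℂ (unitary (Hilb k →L[ℂ] Hilb k) : Set _) := by
    rw [CStarAlgebra.span_unitary]; trivial
  induction hA using Submodule.span_induction with
  | zero => exact ⟨0, fun u => by simp [TensorProduct.map_zero_left]⟩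
  | add A A' _ _ h h' =>
    obtain ⟨C, h⟩ := h
    obtain ⟨C', h'⟩ := h'
    refine ⟨C + C', fun u => ?_⟩
    rw [ContinuousLinearMap.toLinearMap_add, TensorProduct.map_add_left, LinearMap.add_apply,
      add_mul]
    exact (norm_add_le _ _).trans (add_le_add (h u) (h' u))
  | smul c A _ h =>
    obtain ⟨C, h⟩ := h
    refine ⟨‖c‖ * C, fun u => ?_⟩
    rw [ContinuousLinearMap.toLinearMap_smul, TensorProduct.map_smul_left, LinearMap.smul_apply,
      norm_smul, mul_assoc]
    exact mul_le_mul_of_nonneg_left (h u) (norm_nonneg c)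
  | mem A hA =>
    induction hB using Submodule.span_induction with
    | zero => exact ⟨0, fun u => by simp [TensorProduct.map_zero_right]⟩
    | add A A' _ _ h h' =>
      obtain ⟨C, h⟩ := h
      obtain ⟨C', h'⟩ := h'
      refine ⟨C + C', fun u => ?_⟩
      rw [ContinuousLinearMap.toLinearMap_add, TensorProduct.map_add_right, LinearMap.add_apply,
        add_mul]
      exact (norm_add_le _ _).trans (add_le_add (h u) (h' u))
    | smul c A _ h =>
      obtain ⟨C, h⟩ := h
      refine ⟨‖c‖ * C, fun u => ?_⟩
      rw [ContinuousLinearMap.toLinearMap_smul, TensorProduct.map_smul_right, LinearMap.smul_apply,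
        norm_smul, mul_assoc]
      exact mul_le_mul_of_nonneg_left (h u) (norm_nonneg c)
    | mem B hB =>
      refine ⟨1, fun u => ?_⟩
      rw [one_mul]
      exact (TensorProduct.norm_map (Unitary.linearIsometryEquiv ⟨A, hA⟩).toLinearIsometry
        (Unitary.linearIsometryEquiv ⟨B, hB⟩).toLinearIsometry u).le

theorem mem_closedBall_split {m k : ℕ} (x y : Fin (m + k) → ℝ) {r : ℝ} (hr : 0 ≤ r) :
    y ∈ Metric.closedBall x r ↔
      left y ∈ Metric.closedBall (left x) r ∧ right y ∈ Metric.closedBall (right x) r := by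
  simp only [Metric.mem_closedBall, dist_pi_le_iff hr]
  exact ⟨fun h => ⟨fun i => h _, fun i => h _⟩,
    fun h i => Fin.addCases (fun i => h.1 i) (fun i => h.2 i) i⟩

theorem setIntegral_closedBall_eq_zero {m k : ℕ} {h : Hilb (m + k)}
    (hh : ∀ f g, ⟪tensorVec f g, h⟫_ℂ = 0) (x : Fin (m + k) → ℝ) {r : ℝ} (hr : 0 ≤ r) :
    ∫ y in Metric.closedBall x r, h y = 0 := by
  have hm : MeasurableSet (Metric.closedBall (left x : Fin m → ℝ) r) :=
    Metric.isClosed_closedBall.measurableSet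
  have hk : MeasurableSet (Metric.closedBall (right x : Fin k → ℝ) r) :=
    Metric.isClosed_closedBall.measurableSet
  have hmv : volume (Metric.closedBall (left x : Fin m → ℝ) r) ≠ ⊤ :=
    measure_closedBall_lt_top.ne
  have hkv : volume (Metric.closedBall (right x : Fin k → ℝ) r) ≠ ⊤ :=
    measure_closedBall_lt_top.ne
  have h0 := hh (indicatorConstLp 2 hm hmv 1) (indicatorConstLp 2 hk hkv 1)
  rw [L2.inner_def] at h0
  rw [← integral_indicator Metric.isClosed_closedBall.measurableSet, ← h0]
  refine integral_congr_ae ?_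
  filter_upwards [coeFn_tensorVec (indicatorConstLp 2 hm hmv (1 : ℂ))
      (indicatorConstLp 2 hk hkv (1 : ℂ)),
    (quasi_left m k).ae (indicatorConstLp_coeFn (p := 2) (hs := hm) (hμs := hmv) (c := (1 : ℂ))),
    (quasi_right m k).ae (indicatorConstLp_coeFn (p := 2) (hs := hk) (hμs := hkv) (c := (1 : ℂ)))]
    with y h1 h2 h3
  rw [h1, h2, h3, RCLike.inner_apply]
  by_cases hy : y ∈ Metric.closedBall x r
  · have hy' := (mem_closedBall_split x y hr).1 hy
    simp [Set.indicator_of_mem, hy, hy'.1, hy'.2]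
  · rw [Set.indicator_of_notMem hy]
    rw [mem_closedBall_split x y hr, not_and_or] at hy
    rcases hy with hy | hy <;> simp [Set.indicator_of_notMem hy]

theorem denseRange_tensorMap (m k : ℕ) : DenseRange (tensorMap m k) := by
  have key : (LinearMap.range (tensorMap m k)).topologicalClosure = ⊤ := by
    rw [Submodule.topologicalClosure_eq_top_iff, Submodule.eq_bot_iff]
    intro h hh
    have hh' : ∀ f g, ⟪tensorVec f g, h⟫_ℂ = 0 := fun f g =>
      (Submodule.mem_orthogonal _ _).1 hh _ ⟨f ⊗ₜ g, rfl⟩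
    have hl : LocallyIntegrable (h : (Fin (m + k) → ℝ) → ℂ) volume :=
      (Lp.memLp h).locallyIntegrable one_le_two
    refine (Lp.eq_zero_iff_ae_eq_zero).2 ?_
    filter_upwards [IsUnifLocDoublingMeasure.ae_tendsto_average volume hl 1] with x hx
    have hδ : Tendsto (fun j : ℕ => 1 / ((j : ℝ) + 1)) atTop (𝓝[>] 0) :=
      tendsto_nhdsWithin_iff.2 ⟨tendsto_one_div_add_atTop_nhds_zero_nat,
        Eventually.of_forall fun j => Set.mem_Ioi.2 (by positivity)⟩
    have ht := hx (fun _ : ℕ => x) _ hδ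
      (Eventually.of_forall fun j => Metric.mem_closedBall_self (by positivity))
    have h0 : ∀ j : ℕ, ⨍ y in Metric.closedBall x (1 / ((j : ℝ) + 1)), h y = 0 := fun j => by
      rw [setAverage_eq, setIntegral_closedBall_eq_zero hh' x (by positivity), smul_zero]
    simp only [h0] at ht
    exact (tendsto_nhds_unique ht tendsto_const_nhds)
  intro v
  have : v ∈ (LinearMap.range (tensorMap m k)).topologicalClosure := key ▸ Submodule.mem_top
  exact this

/-- The tensor product `A ⊗ B` of bounded operators on `L²(ℝᵐ)` and `L²(ℝᵏ)`, as an operator on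
`L²(ℝᵐ⁺ᵏ)`: the bounded extension of the algebraic tensor product along the dense isometric
inclusion `L²(ℝᵐ) ⊗ L²(ℝᵏ) → L²(ℝᵐ⁺ᵏ)`. -/
def tensorOp {m k : ℕ} (A : Hilb m →L[ℂ] Hilb m) (B : Hilb k →L[ℂ] Hilb k) :
    Hilb (m + k) →L[ℂ] Hilb (m + k) :=
  (tensorMap m k ∘ₗ TensorProduct.map (A : Hilb m →ₗ[ℂ] Hilb m)
    (B : Hilb k →ₗ[ℂ] Hilb k)).extendOfNorm (tensorMap m k)

/-- `A ⊗ B` is the operator with `(A ⊗ B)(f ⊗ g) = A f ⊗ B g`. -/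
theorem tensorOp_tensorVec {m k : ℕ} (A : Hilb m →L[ℂ] Hilb m) (B : Hilb k →L[ℂ] Hilb k)
    (f : Hilb m) (g : Hilb k) :
    tensorOp A B (tensorVec f g) = tensorVec (A f) (B g) := by
  obtain ⟨C, hC⟩ := exists_bound_map A B
  refine LinearMap.extendOfNorm_eq (denseRange_tensorMap m k) ⟨C, fun u => ?_⟩ (f ⊗ₜ g)
  rw [LinearMap.comp_apply, norm_tensorMap, norm_tensorMap]
  exact hC u

/-! ### States, traces and the Zak-Gross Wigner function -/

/-- The index set of a fixed Hilbert basis of `L²(ℝⁿ)`. -/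
def basisIndex (n : ℕ) : Set (Hilb n) := (exists_hilbertBasis ℂ (Hilb n)).choose

/-- A fixed Hilbert basis of `L²(ℝⁿ)`. -/
def basis (n : ℕ) : HilbertBasis (basisIndex n) ℂ (Hilb n) :=
  (exists_hilbertBasis ℂ (Hilb n)).choose_spec.choose

/-- The trace `∑ᵢ ⟨eᵢ, C eᵢ⟩` of a trace-class operator `C` (it does not depend on the Hilbert basis
`(eᵢ)`). -/
def trace {n : ℕ} (C : Hilb n →L[ℂ] Hilb n) : ℂ := ∑' i, ⟪basis n i, C (basis n i)⟫_ℂ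

/-- States (density operators): positive operators of trace one. -/
def IsState {n : ℕ} (ρ : Hilb n →L[ℂ] Hilb n) : Prop :=
  ρ.IsPositive ∧
    ∀ (s : Set (Hilb n)) (e : HilbertBasis s ℂ (Hilb n)), HasSum (fun i => ⟪e i, ρ (e i)⟫_ℂ) 1

/-- The series `Tr(ρ A_η) = (2π)⁻ⁿ ∑_a exp(iℓ[a, η] + iπ a_X · a_Z) Tr(ρ T_a)` converges absolutely
(its coefficients have modulus one, so this does not depend on `η`). -/
def HasConvergentWigner {n : ℕ} (d : ℕ) (ρ : Hilb n →L[ℂ] Hilb n) : Prop :=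
  Summable fun a : Phase ℤ n => trace (ρ ∘L T d (toReal a))

/-- `W` is an integrable function on `[0, dℓ)^{2n}` whose Fourier series is the series
`Tr(ρ A_η) = (2π)⁻ⁿ ∑_a exp(iℓ[a, η] + iπ a_X · a_Z) Tr(ρ T_a)`. -/
def HasWignerSeries {n : ℕ} (d : ℕ) (ρ : Hilb n →L[ℂ] Hilb n) (W : Phase ℝ n → ℂ) : Prop :=
  IntegrableOn W (cell d n) ∧
    ∀ a : Phase ℤ n,
      ∫ η in cell d n, Complex.exp (-(Complex.I * ((ell d * symp (toReal a) η : ℝ) : ℂ))) * W η =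
        ((d * ell d : ℝ) : ℂ) ^ (2 * n) * (1 / (2 * (Real.pi : ℂ)) ^ n *
          (Complex.exp (Complex.I * ((Real.pi * ((toReal a).1 ⬝ᵥ (toReal a).2) : ℝ) : ℂ)) *
            trace (ρ ∘L T d (toReal a))))

open Classical in
/-- The Zak-Gross Wigner function `W_ρ(η) = Tr(ρ A_η)`.
If the series `Tr(ρ A_η) = (2π)⁻ⁿ ∑_a exp(iℓ[a, η] + iπ a_X · a_Z) Tr(ρ T_a)` converges absolutely,
then `W_ρ(η)` is its sum, for every `η`. For a general state the series need not converge
pointwise; then it is the Fourier series of an integrable function on `[0, dℓ)^{2n}`, unique up to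
null sets, and `W_ρ` is that function. (The last branch is only there to make the function total: every trace-class
operator has such an integrable function, a sum of products of Zak transforms.) -/
def wigner {n : ℕ} (d : ℕ) (ρ : Hilb n →L[ℂ] Hilb n) : Phase ℝ n → ℂ :=
  if HasConvergentWigner d ρ then fun η =>
    1 / (2 * (Real.pi : ℂ)) ^ n *
      ∑' a : Phase ℤ n, phaseCoeff d η a * trace (ρ ∘L T d (toReal a))
  else if h : ∃ W, HasWignerSeries d ρ W then h.choose
  else 0

/-- The negativity (negative volume) `M_ρ = ∫ |W_ρ(η)| dη` over `[0, dℓ)^{2n}`. -/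
def negativity {n : ℕ} (d : ℕ) (ρ : Hilb n →L[ℂ] Hilb n) : ℝ :=
  ∫ η in cell d n, ‖wigner d ρ η‖

end ZakGross

end

noncomputable section

namespace ZakGross

/-! ### Displacement operators of composite systems -/

/-! Both the displacement operators and their phases factorise over modes. The forms `[a, η]` and
`a_X · a_Z` are sums over modes and `exp` turns these sums into products, so `T_a` acts on `f ⊗ g`
as `T` of the first part of `a` on `f`, tensored with `T` of the second part on `g` (`T_tensorVec`).
The lattice of the composite system is the product of the two lattices, and a product of two
absolutely convergent series is the absolutely convergent series over the product
(`phaseSum_split`). This settles matrix elements between product vectors. For arbitrary pairs, the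
rectangles `S₁ × S₂` are cofinal among the finite subsets. Matrix elements between Schwartz
functions decay faster than any polynomial in the displacement, hence are summable.

For states, `ρ = ∑ |v_j⟩⟨v_j|` with `∑ ‖v_j‖² < ∞`, and `Tr(ρA) = ∑ ⟨v_j, A v_j⟩`. The vectors `v_j
⊗ w_i` decompose `ρ ⊗ σ` in the same way, so the traces, i.e. the Fourier coefficients of the Wigner
functions, are multiplicative (`trace_tensorOp_T`).

When the series do not converge absolutely, the Wigner function is known only through its Fourier
coefficients, so existence and uniqueness of an integrable function with these coefficients are
needed. Uniqueness is the density of trigonometric polynomials (`ae_eq_zero_of_fourier`). Existence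
uses Zak transforms. For a residue class `s` modulo `d` let `Z_s f(q, p) = ∑ exp(-iℓ u·p) f(q + ℓu)`
over `u ≡ s`; up to the factor `(dℓ)ⁿ` in squared norms this is an isometry into `L²` of the cell.
Then `∑_s conj(Z_s f) Z_{-s} f` is integrable with norm at most `C‖f‖²`. In its coefficient at `a`
only the class with `2s = a_X` survives. As `d` is odd there is exactly one such class, and the
phase it produces is the one in the definition of `A_η` (`sum_inner_zak`). Summation over the `v_j`
in `L¹` gives the function of a state.

By Fubini the product of the two Wigner functions has the Fourier coefficients of the Wigner
function of `ρ ⊗ σ`, so they agree almost everywhere. Integrating absolute values gives the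
negativity. -/

theorem coeFn_translation {n : ℕ} (s : Fin n → ℝ) (f : Hilb n) :
    translation s f =ᵐ[volume] fun x => f (x - s) :=
  Lp.coeFn_compMeasurePreserving f (measurePreserving_sub_right volume s)

theorem coeFn_modulation {n : ℕ} (t : Fin n → ℝ) (f : Hilb n) :
    modulation t f =ᵐ[volume] fun x => Complex.exp (Complex.I * ((t ⬝ᵥ x : ℝ) : ℂ)) * f x :=
  (memLp_modulation t f).coeFn_toLp

theorem coeFn_translation_modulation {n : ℕ} (s t : Fin n → ℝ) (f : Hilb n) :
    translation s (modulation t f) =ᵐ[volume]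
      fun x => Complex.exp (Complex.I * ((t ⬝ᵥ (x - s) : ℝ) : ℂ)) * f (x - s) :=
  (coeFn_translation s _).trans
    ((measurePreserving_sub_right volume s).quasiMeasurePreserving.ae (coeFn_modulation t f))

theorem T_apply {n : ℕ} (d : ℕ) (a : Phase ℝ n) (f : Hilb n) :
    T d a f = Complex.exp (Complex.I * ((Real.pi * (a.1 ⬝ᵥ a.2) / d : ℝ) : ℂ)) •
      translation (ell d • a.1) (modulation (ell d • a.2) f) := rfl

theorem coeFn_T {n : ℕ} (d : ℕ) (a : Phase ℝ n) (f : Hilb n) :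
    T d a f =ᵐ[volume] fun x => Complex.exp (Complex.I * ((Real.pi * (a.1 ⬝ᵥ a.2) / d : ℝ) : ℂ)) *
      (Complex.exp (Complex.I * (((ell d • a.2) ⬝ᵥ (x - ell d • a.1) : ℝ) : ℂ)) *
        f (x - ell d • a.1)) := by
  rw [T_apply]
  filter_upwards [Lp.coeFn_smul (Complex.exp (Complex.I * ((Real.pi * (a.1 ⬝ᵥ a.2) / d : ℝ) : ℂ)))
    (translation (ell d • a.1) (modulation (ell d • a.2) f)),
    coeFn_translation_modulation (ell d • a.1) (ell d • a.2) f] with x h1 h2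
  rw [h1, Pi.smul_apply, h2, smul_eq_mul]

theorem dotProduct_split {R : Type} [NonUnitalNonAssocSemiring R] {m k : ℕ}
    (x y : Fin (m + k) → R) : x ⬝ᵥ y = left x ⬝ᵥ left y + right x ⬝ᵥ right y :=
  Fin.sum_univ_add _

/-- Both dot products in the exponents split into the two blocks of modes. The almost-everywhere
formulas on each factor are pulled back along the two projections, which are
quasi-measure-preserving. -/
theorem T_tensorVec {m k : ℕ} (d : ℕ) (a : Phase ℝ (m + k)) (f : Hilb m) (g : Hilb k) :
    T d a (tensorVec f g) = tensorVec (T d (fstModes a) f) (T d (sndModes a) g) := by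
  refine Lp.ext ?_
  filter_upwards [coeFn_T d a (tensorVec f g),
    (measurePreserving_sub_right volume (ell d • a.1)).quasiMeasurePreserving.ae
      (coeFn_tensorVec f g),
    coeFn_tensorVec (T d (fstModes a) f) (T d (sndModes a) g),
    (quasi_left m k).ae (coeFn_T d (fstModes a) f),
    (quasi_right m k).ae (coeFn_T d (sndModes a) g)] with x h1 h2 h3 h4 h5
  rw [h1, h2, h3, h4, h5, dotProduct_split a.1 a.2,
    dotProduct_split (ell d • a.2) (x - ell d • a.1)]
  -- Taking a block of coordinates commutes definitionally with subtraction and scaling.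
  change _ * (_ * (f (left x - ell d • left a.1) * g (right x - ell d • right a.1))) = _
  change Complex.exp (Complex.I * ((Real.pi * (left a.1 ⬝ᵥ left a.2 + right a.1 ⬝ᵥ right a.2) / d :
      ℝ) : ℂ)) * (Complex.exp (Complex.I *
      (((ell d • left a.2) ⬝ᵥ (left x - ell d • left a.1) +
        (ell d • right a.2) ⬝ᵥ (right x - ell d • right a.1) : ℝ) : ℂ)) * _) =
    (Complex.exp (Complex.I * ((Real.pi * (left a.1 ⬝ᵥ left a.2) / d : ℝ) : ℂ)) *
      (Complex.exp (Complex.I * (((ell d • left a.2) ⬝ᵥ (left x - ell d • left a.1) : ℝ) : ℂ)) *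
        f (left x - ell d • left a.1))) *
    (Complex.exp (Complex.I * ((Real.pi * (right a.1 ⬝ᵥ right a.2) / d : ℝ) : ℂ)) *
      (Complex.exp (Complex.I * (((ell d • right a.2) ⬝ᵥ (right x - ell d • right a.1) : ℝ) : ℂ)) *
        g (right x - ell d • right a.1)))
  rw [mul_add, add_div, Complex.ofReal_add, mul_add, Complex.exp_add, Complex.ofReal_add, mul_add,
    Complex.exp_add]
  ring

/-- Product vectors span a dense subspace, and bounded operators are continuous. -/
theorem clm_ext_tensorVec {m k : ℕ} {A B : Hilb (m + k) →L[ℂ] Hilb (m + k)}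
    (h : ∀ f g, A (tensorVec f g) = B (tensorVec f g)) : A = B := by
  have : (A : Hilb (m + k) → Hilb (m + k)) ∘ tensorMap m k = B ∘ tensorMap m k := by
    have e : (A : Hilb (m + k) →ₗ[ℂ] Hilb (m + k)) ∘ₗ tensorMap m k =
        (B : Hilb (m + k) →ₗ[ℂ] Hilb (m + k)) ∘ₗ tensorMap m k :=
      TensorProduct.ext' fun f g => h f g
    exact congrArg DFunLike.coe e
  exact ContinuousLinearMap.coeFn_injective
    ((denseRange_tensorMap m k).equalizer A.continuous B.continuous this)

/-- Exposes bilinearity, so that `map_sum` and `map_smul` apply to product vectors. -/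
theorem tensorVec_eq_bilin {m k : ℕ} (f : Hilb m) (g : Hilb k) :
    tensorVec f g = tensorBilin m k f g := rfl

theorem tensorOp_T {m k : ℕ} (d : ℕ) (a : Phase ℝ (m + k)) :
    tensorOp (T d (fstModes a)) (T d (sndModes a)) = T d a :=
  clm_ext_tensorVec fun f g => by rw [tensorOp_tensorVec, T_tensorVec]

theorem tensorOp_sum_smul {m k : ℕ} {ι κ : Type} (S : Finset ι) (S' : Finset κ) (c : ι → ℂ)
    (c' : κ → ℂ) (A : ι → Hilb m →L[ℂ] Hilb m) (B : κ → Hilb k →L[ℂ] Hilb k) :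
    tensorOp (∑ i ∈ S, c i • A i) (∑ j ∈ S', c' j • B j) =
      ∑ p ∈ S ×ˢ S', (c p.1 * c' p.2) • tensorOp (A p.1) (B p.2) := by
  refine clm_ext_tensorVec fun f g => ?_
  simp only [tensorOp_tensorVec, sum_apply, smul_apply]
  simp only [Finset.sum_product, tensorVec_eq_bilin, map_sum, LinearMap.sum_apply, map_smul,
    LinearMap.smul_apply, Finset.smul_sum, smul_smul]
  rw [Finset.sum_comm]
  simp only [mul_comm]

theorem tensorOp_smul_smul {m k : ℕ} (c c' : ℂ) (A : Hilb m →L[ℂ] Hilb m)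
    (B : Hilb k →L[ℂ] Hilb k) : tensorOp (c • A) (c' • B) = (c * c') • tensorOp A B := by
  refine clm_ext_tensorVec fun f g => ?_
  simp only [tensorOp_tensorVec, smul_apply]
  simp only [tensorVec_eq_bilin, map_smul, LinearMap.smul_apply, smul_smul]
  rw [mul_comm]

/-! ### Factorisation of the phases and of the lattice sums -/

/-- The modes of a composite system are those of its two parts. -/
def modesEquiv (R : Type) (m k : ℕ) : Phase R (m + k) ≃ Phase R m × Phase R k where
  toFun a := (fstModes a, sndModes a)
  invFun p := (Fin.append p.1.1 p.2.1, Fin.append p.1.2 p.2.2)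
  left_inv a := by
    refine Prod.ext (funext fun i => ?_) (funext fun i => ?_) <;>
      refine Fin.addCases (fun i => ?_) (fun i => ?_) i <;> simp [fstModes, sndModes, left, right]
  right_inv p := by
    refine Prod.ext (Prod.ext ?_ ?_) (Prod.ext ?_ ?_) <;> funext i <;>
      simp [fstModes, sndModes, left, right]

theorem symp_split {m k : ℕ} (a b : Phase ℝ (m + k)) :
    symp a b = symp (fstModes a) (fstModes b) + symp (sndModes a) (sndModes b) := by
  simp only [symp, dotProduct_split a.1 b.2, dotProduct_split a.2 b.1, fstModes, sndModes]
  ring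

theorem phaseCoeff_split {m k : ℕ} (d : ℕ) (η : Phase ℝ (m + k)) (a : Phase ℤ (m + k)) :
    phaseCoeff d η a =
      phaseCoeff d (fstModes η) (fstModes a) * phaseCoeff d (sndModes η) (sndModes a) := by
  have h := dotProduct_split (toReal a).1 (toReal a).2
  rw [phaseCoeff, phaseCoeff, phaseCoeff, ← Complex.exp_add, ← mul_add, ← Complex.ofReal_add,
    symp_split, h]
  congr 3
  change _ = ell d * symp (fstModes (toReal a)) (fstModes η) +
      Real.pi * (left (toReal a).1 ⬝ᵥ left (toReal a).2) +
    (ell d * symp (sndModes (toReal a)) (sndModes η) +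
      Real.pi * (right (toReal a).1 ⬝ᵥ right (toReal a).2))
  ring

theorem norm_phaseCoeff {n : ℕ} (d : ℕ) (η : Phase ℝ n) (a : Phase ℤ n) :
    ‖phaseCoeff d η a‖ = 1 := by
  rw [phaseCoeff, mul_comm Complex.I, Complex.norm_exp_ofReal_mul_I]

theorem summable_phaseCoeff_mul {n : ℕ} (d : ℕ) (η : Phase ℝ n) {u : Phase ℤ n → ℂ}
    (hu : Summable u) : Summable fun a => phaseCoeff d η a * u a := by
  refine Summable.of_norm ?_
  simpa only [norm_mul, norm_phaseCoeff, one_mul] using hu.norm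

theorem summable_modes_mul {m k : ℕ} {u : Phase ℤ m → ℂ} {v : Phase ℤ k → ℂ} (hu : Summable u)
    (hv : Summable v) : Summable fun a : Phase ℤ (m + k) => u (fstModes a) * v (sndModes a) :=
  (modesEquiv ℤ m k).summable_iff.2 (summable_mul_of_summable_norm hu.norm hv.norm)

/-- The common core of the product formulas for matrix elements and for convergent Wigner series.
The sequences `u`, `v` stand for `⟨f, T_a g⟩` in the former and for `Tr(ρ T_a)` in the latter. -/
theorem phaseSum_split {m k : ℕ} (d : ℕ) (η : Phase ℝ (m + k)) {u : Phase ℤ m → ℂ}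
    {v : Phase ℤ k → ℂ} (hu : Summable u) (hv : Summable v) :
    1 / (2 * (Real.pi : ℂ)) ^ (m + k) *
        ∑' a : Phase ℤ (m + k), phaseCoeff d η a * (u (fstModes a) * v (sndModes a)) =
      (1 / (2 * (Real.pi : ℂ)) ^ m * ∑' a, phaseCoeff d (fstModes η) a * u a) *
        (1 / (2 * (Real.pi : ℂ)) ^ k * ∑' a, phaseCoeff d (sndModes η) a * v a) := by
  have e : ∑' a : Phase ℤ (m + k), phaseCoeff d η a * (u (fstModes a) * v (sndModes a)) =
      (∑' a, phaseCoeff d (fstModes η) a * u a) * ∑' a, phaseCoeff d (sndModes η) a * v a := by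
    rw [tsum_mul_tsum_of_summable_norm (summable_phaseCoeff_mul d _ hu).norm
      (summable_phaseCoeff_mul d _ hv).norm, ← (modesEquiv ℤ m k).tsum_eq]
    refine tsum_congr fun a => ?_
    rw [phaseCoeff_split]
    simp only [modesEquiv, Equiv.coe_fn_mk]
    ring
  rw [e, pow_add, ← one_div_mul_one_div]
  ring

/-! ### Matrix elements of the phase-point operators -/

theorem inner_tensorVec_T {m k : ℕ} (d : ℕ) (a : Phase ℤ (m + k)) (f₁ g₁ : Hilb m)
    (f₂ g₂ : Hilb k) :
    ⟪tensorVec f₁ f₂, T d (toReal a) (tensorVec g₁ g₂)⟫_ℂ =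
      ⟪f₁, T d (toReal (fstModes a)) g₁⟫_ℂ * ⟪f₂, T d (toReal (sndModes a)) g₂⟫_ℂ := by
  rw [T_tensorVec, inner_tensorVec]
  rfl

theorem inFormDomain_tensorVec {m k : ℕ} {d : ℕ} {f₁ g₁ : Hilb m} {f₂ g₂ : Hilb k}
    (h₁ : InFormDomain d f₁ g₁) (h₂ : InFormDomain d f₂ g₂) :
    InFormDomain d (tensorVec f₁ f₂) (tensorVec g₁ g₂) := by
  rw [InFormDomain]
  simp only [inner_tensorVec_T]
  exact summable_modes_mul (u := fun a => ⟪f₁, T d (toReal a) g₁⟫_ℂ)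
    (v := fun a => ⟪f₂, T d (toReal a) g₂⟫_ℂ) h₁ h₂

theorem phasePoint_tensorVec {m k : ℕ} {d : ℕ} {f₁ g₁ : Hilb m} {f₂ g₂ : Hilb k}
    (h₁ : InFormDomain d f₁ g₁) (h₂ : InFormDomain d f₂ g₂) (η : Phase ℝ (m + k)) :
    phasePoint d η (tensorVec f₁ f₂) (tensorVec g₁ g₂) =
      phasePoint d (fstModes η) f₁ g₁ * phasePoint d (sndModes η) f₂ g₂ := by
  rw [phasePoint]
  simp only [inner_tensorVec_T]
  exact phaseSum_split d η (u := fun a => ⟪f₁, T d (toReal a) g₁⟫_ℂ)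
    (v := fun a => ⟪f₂, T d (toReal a) g₂⟫_ℂ) h₁ h₂

/-- The tensor product of two truncations is the truncation over the rectangle `S₁ × S₂`. Rectangles
tend to `atTop` among finite subsets of the product lattice, so the unconditional sum is also the
limit along them. -/
theorem tendsto_inner_tensorOp_phasePointTrunc {m k : ℕ} {d : ℕ} {F G : Hilb (m + k)}
    (h : InFormDomain d F G) (η : Phase ℝ (m + k)) :
    Tendsto (fun S : Finset (Phase ℤ m) × Finset (Phase ℤ k) =>
        ⟪F, tensorOp (phasePointTrunc d (fstModes η) S.1)
          (phasePointTrunc d (sndModes η) S.2) G⟫_ℂ)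
      atTop (𝓝 (phasePoint d η F G)) := by
  have hs := ((modesEquiv ℤ m k).symm.hasSum_iff.2 (summable_phaseCoeff_mul d η h).hasSum)
  have hp : Tendsto (fun S : Finset (Phase ℤ m) × Finset (Phase ℤ k) => S.1 ×ˢ S.2) atTop atTop :=
    tendsto_finsetProd_atTop
  refine ((hs.comp hp).const_mul (1 / (2 * (Real.pi : ℂ)) ^ (m + k))).congr fun S => ?_
  rw [phasePointTrunc, phasePointTrunc, tensorOp_smul_smul, tensorOp_sum_smul,
    smul_apply, inner_smul_right, sum_apply, inner_sum,
    pow_add, one_div_mul_one_div]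
  simp only [Function.comp_apply]
  congr 1
  refine Finset.sum_congr rfl fun p _ => ?_
  obtain ⟨a, rfl⟩ := (modesEquiv ℤ m k).surjective p
  rw [Equiv.symm_apply_apply, smul_apply, inner_smul_right, phaseCoeff_split,
    ← tensorOp_T]
  rfl

/-! ### Matrix elements between Schwartz functions -/

theorem summable_fin_prod {f : ℤ → ℝ} (h0 : ∀ a, 0 ≤ f a) (hf : Summable f) (n : ℕ) :
    Summable fun a : Fin n → ℤ => ∏ i, f (a i) := by
  induction n with
  | zero => exact (hasSum_fintype _).summable
  | succ n ih =>
    refine (Fin.consEquiv fun _ : Fin (n + 1) => ℤ).summable_iff.1 ?_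
    refine (hf.mul_of_nonneg ih h0 fun a => Finset.prod_nonneg fun i _ => h0 _).congr fun p => ?_
    simp [Fin.prod_univ_succ, Fin.consEquiv]

theorem ell_pos {d : ℕ} (hd : 0 < d) : 0 < ell d :=
  Real.sqrt_pos.2 (by have := Real.pi_pos; positivity)

theorem ell_sq {d : ℕ} (hd : 0 < d) : d * (ell d * ell d) = 2 * Real.pi := by
  rw [ell, Real.mul_self_sqrt (by have := Real.pi_pos; positivity)]
  field_simp

theorem summable_inv_one_add_mul_sq {c : ℝ} (hc : 0 < c) :
    Summable fun a : ℤ => (1 + (c * a) * (c * a))⁻¹ := by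
  have h := (Real.summable_one_div_int_pow (p := 2)).2 one_lt_two
  refine Summable.of_norm_bounded_eventually (h.mul_left (1 / (c * c))) ?_
  -- The comparison with `1 / (c a)²` fails only at `a = 0`, where division by zero makes the bound
  -- `0`.
  refine (Set.finite_singleton (0 : ℤ)).subset fun a ha => ?_
  by_contra h0
  have h0' : (a : ℝ) ≠ 0 := by simpa using h0
  refine ha ?_
  have : 0 < (a : ℝ) ^ 2 := by positivity
  change ‖(1 + c * (a : ℝ) * (c * a))⁻¹‖ ≤ 1 / (c * c) * (1 / (a : ℝ) ^ 2)
  have h1 : 0 < 1 + c * (a : ℝ) * (c * a) := by nlinarith [mul_self_nonneg (c * (a : ℝ))]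
  rw [Real.norm_of_nonneg (inv_nonneg.2 h1.le), one_div_mul_one_div, ← one_div]
  refine one_div_le_one_div_of_le (by positivity) ?_
  nlinarith

/-- The matrix element `⟨φ, exp(-i s · p̂) exp(i t · q̂) ψ⟩` between Schwartz functions. -/
def schwartzElem {n : ℕ} (φ ψ : 𝓢(Fin n → ℝ, ℂ)) (s t : Fin n → ℝ) : ℂ :=
  ∫ x, (starRingEnd ℂ) (φ x) * (Complex.exp (Complex.I * ((t ⬝ᵥ (x - s) : ℝ) : ℂ)) * ψ (x - s))

section Schwartz

variable {n : ℕ} (φ ψ : 𝓢(Fin n → ℝ, ℂ)) (s t : Fin n → ℝ)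

theorem norm_exp_I_mul (r : ℝ) : ‖Complex.exp (Complex.I * (r : ℂ))‖ = 1 := by
  rw [mul_comm, Complex.norm_exp_ofReal_mul_I]

theorem continuous_displaced :
    Continuous fun x => Complex.exp (Complex.I * ((t ⬝ᵥ (x - s) : ℝ) : ℂ)) * ψ (x - s) := by
  have := ψ.continuous
  unfold dotProduct
  fun_prop

theorem norm_displaced_le (x : Fin n → ℝ) :
    ‖Complex.exp (Complex.I * ((t ⬝ᵥ (x - s) : ℝ) : ℂ)) * ψ (x - s)‖ ≤
      SchwartzMap.seminorm ℝ 0 0 ψ := by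
  rw [norm_mul, norm_exp_I_mul, one_mul]
  exact ψ.norm_le_seminorm ℝ _

theorem integrable_schwartzElem :
    Integrable fun x => (starRingEnd ℂ) (φ x) *
      (Complex.exp (Complex.I * ((t ⬝ᵥ (x - s) : ℝ) : ℂ)) * ψ (x - s)) := by
  have hφ : Integrable (fun x => (starRingEnd ℂ) (φ x)) :=
    Complex.conjLIE.integrable_comp_iff.2 φ.integrable
  exact hφ.mul_bdd (c := SchwartzMap.seminorm ℝ 0 0 ψ)
    (continuous_displaced ψ s t).aestronglyMeasurable
    (Eventually.of_forall (norm_displaced_le ψ s t))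

theorem norm_schwartzElem_le :
    ‖schwartzElem φ ψ s t‖ ≤ (∫ x, ‖φ x‖) * SchwartzMap.seminorm ℝ 0 0 ψ := by
  rw [← integral_mul_const]
  refine norm_integral_le_of_norm_le (φ.integrable.norm.mul_const _)
    (Eventually.of_forall fun x => ?_)
  rw [norm_mul, RCLike.norm_conj]
  exact mul_le_mul_of_nonneg_left (norm_displaced_le ψ s t x) (norm_nonneg _)

/-- Multiplication of a Schwartz function with a coordinate. -/
def mulCoord (i : Fin n) (φ : 𝓢(Fin n → ℝ, ℂ)) : 𝓢(Fin n → ℝ, ℂ) :=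
  SchwartzMap.smulLeftCLM ℂ (fun x : Fin n → ℝ => x i) φ

theorem mulCoord_apply (i : Fin n) (x : Fin n → ℝ) : mulCoord i φ x = (x i : ℂ) * φ x := by
  have h : Function.HasTemperateGrowth fun x : Fin n → ℝ => x i :=
    (ContinuousLinearMap.proj (R := ℝ) (φ := fun _ : Fin n => ℝ) i).hasTemperateGrowth
  rw [mulCoord, SchwartzMap.smulLeftCLM_apply_apply h, Complex.real_smul]

/-- Write `s i = x i - (x i - s i)`: the first term multiplies `φ x`, the second multiplies `ψ (x -
s)`. -/
theorem coord_mul_schwartzElem (i : Fin n) :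
    (s i : ℂ) * schwartzElem φ ψ s t =
      schwartzElem (mulCoord i φ) ψ s t - schwartzElem φ (mulCoord i ψ) s t := by
  rw [schwartzElem, schwartzElem, schwartzElem,
    ← integral_sub (integrable_schwartzElem _ _ s t) (integrable_schwartzElem _ _ s t),
    ← integral_const_mul]
  refine integral_congr_ae (Eventually.of_forall fun x => ?_)
  simp only [mulCoord_apply, map_mul, Complex.conj_ofReal, Pi.sub_apply, Complex.ofReal_sub]
  ring

open LineDeriv in
-- Integration by parts in direction `i`: the factor `I * t i` is the derivative of the exponential,
-- traded for derivatives of `φ` and `ψ`.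
theorem freq_mul_schwartzElem (i : Fin n) :
    Complex.I * (t i : ℂ) * schwartzElem φ ψ s t =
      -schwartzElem (∂_{(Pi.single i 1 : Fin n → ℝ)} φ) ψ s t -
        schwartzElem φ (∂_{(Pi.single i 1 : Fin n → ℝ)} ψ) s t := by
  set v : Fin n → ℝ := Pi.single i 1
  let f : (Fin n → ℝ) → ℂ := fun x => (starRingEnd ℂ) (φ x)
  let g : (Fin n → ℝ) → ℂ :=
    fun x => Complex.exp (Complex.I * ((t ⬝ᵥ (x - s) : ℝ) : ℂ)) * ψ (x - s)
  have hf : ∀ x, HasFDerivAt f (Complex.conjCLE.toContinuousLinearMap ∘L fderiv ℝ φ x) x :=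
    fun x => Complex.conjCLE.toContinuousLinearMap.hasFDerivAt.comp x (φ.hasFDerivAt x)
  have hf' : ∀ x, fderiv ℝ f x v = (starRingEnd ℂ) ((∂_{v} φ) x) := fun x => by
    rw [(hf x).fderiv, SchwartzMap.lineDerivOp_apply_eq_fderiv]
    rfl
  have hg : ∀ x, DifferentiableAt ℝ g x := fun x => by
    have := ψ.differentiable
    unfold g dotProduct
    fun_prop
  have hg' : ∀ x, fderiv ℝ g x v = Complex.I * (t i : ℂ) * g x +
      Complex.exp (Complex.I * ((t ⬝ᵥ (x - s) : ℝ) : ℂ)) * (∂_{v} ψ) (x - s) := fun x => by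
    have h1 : HasLineDerivAt ℝ g (fderiv ℝ g x v) x v := (hg x).hasFDerivAt.hasLineDerivAt v
    refine h1.unique ?_
    have h2 : HasLineDerivAt ℝ ψ ((∂_{v} ψ) (x - s)) (x - s) v := by
      rw [SchwartzMap.lineDerivOp_apply_eq_fderiv]
      exact (ψ.hasFDerivAt _).hasLineDerivAt v
    have h3 : ∀ r : ℝ, t ⬝ᵥ (x + r • v - s) = t ⬝ᵥ (x - s) + r * t i := fun r => by
      rw [add_sub_right_comm, dotProduct_add, dotProduct_smul, dotProduct_single, smul_eq_mul,
        mul_one]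
    have h4 : HasDerivAt (fun r : ℝ => Complex.exp (Complex.I * ((t ⬝ᵥ (x + r • v - s) : ℝ) : ℂ)))
        (Complex.exp (Complex.I * ((t ⬝ᵥ (x - s) : ℝ) : ℂ)) * (Complex.I * (t i : ℂ))) 0 := by
      simp only [h3]
      have h5 : HasDerivAt (fun r : ℝ => t ⬝ᵥ (x - s) + r * t i) (t i) 0 := by
        simpa using ((hasDerivAt_id (0 : ℝ)).mul_const (t i)).const_add (t ⬝ᵥ (x - s))
      simpa using (h5.ofReal_comp.const_mul Complex.I).cexp
    have h5 : HasDerivAt (fun r : ℝ => ψ (x + r • v - s)) ((∂_{v} ψ) (x - s)) 0 := by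
      have : HasDerivAt (fun r : ℝ => ψ (x - s + r • v)) ((∂_{v} ψ) (x - s)) 0 := h2
      simpa only [add_sub_right_comm] using this
    have h6 := h4.mul h5
    simp only [zero_smul, add_zero] at h6
    refine h6.congr_deriv ?_
    simp only [g]
    ring
  have i1 := integrable_schwartzElem φ ψ s t
  have i2 := integrable_schwartzElem (∂_{v} φ) ψ s t
  have i3 := integrable_schwartzElem φ (∂_{v} ψ) s t
  have e : ∀ x, f x * fderiv ℝ g x v = Complex.I * (t i : ℂ) * (f x * g x) +
      f x * (Complex.exp (Complex.I * ((t ⬝ᵥ (x - s) : ℝ) : ℂ)) * (∂_{v} ψ) (x - s)) := fun x => by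
    rw [hg']; ring
  have key := integral_mul_fderiv_eq_neg_fderiv_mul_of_integrable (μ := volume) (f := f) (g := g)
    (v := v) (by simpa only [hf'] using i2)
    (by simp only [e]; exact (i1.const_mul _).add i3) i1
    (fun x _ => (hf x).differentiableAt) (fun x _ => hg x)
  simp only [e, hf'] at key
  rw [integral_add (i1.const_mul _) i3, integral_const_mul] at key
  exact eq_sub_of_add_eq key

/-- A weight `w(s, t)` is admissible if it is dominated by the decay of the matrix elements between
Schwartz functions. -/
def IsAdmissibleWeight (w : (Fin n → ℝ) → (Fin n → ℝ) → ℝ) : Prop :=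
  ∀ φ ψ : 𝓢(Fin n → ℝ, ℂ), ∃ C, ∀ s t, |w s t| * ‖schwartzElem φ ψ s t‖ ≤ C

theorem isAdmissibleWeight_one : IsAdmissibleWeight (n := n) fun _ _ => 1 := fun φ ψ =>
  ⟨_, fun s t => by rw [abs_one, one_mul]; exact norm_schwartzElem_le φ ψ s t⟩

theorem IsAdmissibleWeight.add {w w' : (Fin n → ℝ) → (Fin n → ℝ) → ℝ} (h : IsAdmissibleWeight w)
    (h' : IsAdmissibleWeight w') : IsAdmissibleWeight fun s t => w s t + w' s t := fun φ ψ => by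
  obtain ⟨C, hC⟩ := h φ ψ
  obtain ⟨C', hC'⟩ := h' φ ψ
  refine ⟨C + C', fun s t => ?_⟩
  refine (mul_le_mul_of_nonneg_right (abs_add_le _ _) (norm_nonneg _)).trans ?_
  rw [add_mul]
  exact add_le_add (hC s t) (hC' s t)

theorem IsAdmissibleWeight.coord_mul {w : (Fin n → ℝ) → (Fin n → ℝ) → ℝ}
    (h : IsAdmissibleWeight w) (i : Fin n) : IsAdmissibleWeight fun s t => s i * w s t :=
  fun φ ψ => by
    obtain ⟨C, hC⟩ := h (mulCoord i φ) ψ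
    obtain ⟨C', hC'⟩ := h φ (mulCoord i ψ)
    refine ⟨C + C', fun s t => ?_⟩
    have e : |s i * w s t| * ‖schwartzElem φ ψ s t‖ =
        |w s t| * ‖(s i : ℂ) * schwartzElem φ ψ s t‖ := by
      rw [abs_mul, norm_mul, Complex.norm_real, Real.norm_eq_abs]; ring
    rw [e, coord_mul_schwartzElem]
    refine (mul_le_mul_of_nonneg_left (norm_sub_le _ _) (abs_nonneg _)).trans ?_
    rw [mul_add]
    exact add_le_add (hC s t) (hC' s t)

open LineDeriv in
theorem IsAdmissibleWeight.freq_mul {w : (Fin n → ℝ) → (Fin n → ℝ) → ℝ}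
    (h : IsAdmissibleWeight w) (i : Fin n) : IsAdmissibleWeight fun s t => t i * w s t :=
  fun φ ψ => by
    obtain ⟨C, hC⟩ := h (∂_{(Pi.single i 1 : Fin n → ℝ)} φ) ψ
    obtain ⟨C', hC'⟩ := h φ (∂_{(Pi.single i 1 : Fin n → ℝ)} ψ)
    refine ⟨C + C', fun s t => ?_⟩
    have e : |t i * w s t| * ‖schwartzElem φ ψ s t‖ =
        |w s t| * ‖Complex.I * (t i : ℂ) * schwartzElem φ ψ s t‖ := by
      rw [abs_mul, norm_mul, norm_mul, Complex.norm_real, Real.norm_eq_abs, Complex.norm_I]; ring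
    rw [e, freq_mul_schwartzElem]
    refine (mul_le_mul_of_nonneg_left (norm_sub_le _ _) (abs_nonneg _)).trans ?_
    rw [mul_add, norm_neg]
    exact add_le_add (hC s t) (hC' s t)

/-- Admissibility quantifies over all pairs of Schwartz functions, so it survives multiplication by
any `s i` or `t i`, which only replaces `φ` or `ψ` by another Schwartz function. Each new factor
enters through `(1 + x²) w = w + x (x w)`. -/
theorem isAdmissibleWeight_prod (S S' : Finset (Fin n)) :
    IsAdmissibleWeight fun s t => (∏ i ∈ S, (1 + s i * s i)) * ∏ i ∈ S', (1 + t i * t i) := by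
  classical
  induction S using Finset.induction_on with
  | empty =>
    induction S' using Finset.induction_on with
    | empty => simpa using isAdmissibleWeight_one
    | insert i S' hi ih =>
      convert ih.add ((ih.freq_mul i).freq_mul i) using 3
      rw [Finset.prod_insert hi]; ring
  | insert i S hi ih =>
    convert ih.add ((ih.coord_mul i).coord_mul i) using 3
    rw [Finset.prod_insert hi]; ring

end Schwartz

theorem norm_inner_T_toLp {n : ℕ} (d : ℕ) (φ ψ : 𝓢(Fin n → ℝ, ℂ)) (a : Phase ℝ n) :
    ‖⟪φ.toLp 2, T d a (ψ.toLp 2)⟫_ℂ‖ =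
      ‖schwartzElem φ ψ (ell d • a.1) (ell d • a.2)‖ := by
  rw [T_apply, inner_smul_right, norm_mul, norm_exp_I_mul, one_mul, L2.inner_def, schwartzElem]
  congr 1
  refine integral_congr_ae ?_
  filter_upwards [φ.coeFn_toLp 2 volume,
    coeFn_translation_modulation (ell d • a.1) (ell d • a.2) (ψ.toLp 2),
    (measurePreserving_sub_right volume (ell d • a.1)).quasiMeasurePreserving.ae
      (ψ.coeFn_toLp 2 volume)] with x h1 h2 h3
  rw [h1, h2, h3, RCLike.inner_apply, mul_comm]

/-- With this weight the bound on the matrix elements is a product of `2n` one-dimensional terms `(1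
+ (ℓ a_i)²)⁻¹`, each summable over `ℤ`. -/
theorem inFormDomain_schwartz {d : ℕ} (hd : 0 < d) {n : ℕ} (φ ψ : 𝓢(Fin n → ℝ, ℂ)) :
    InFormDomain d (φ.toLp 2) (ψ.toLp 2) := by
  obtain ⟨C, hC⟩ := isAdmissibleWeight_prod Finset.univ Finset.univ φ ψ
  have h0 : ∀ r : ℝ, 0 < 1 + r * r := fun r => by nlinarith [mul_self_nonneg r]
  have h0' : ∀ r : ℝ, 0 ≤ (1 + r * r)⁻¹ := fun r => inv_nonneg.2 (h0 r).le
  have h1 := summable_fin_prod (fun a => h0' _) (summable_inv_one_add_mul_sq (ell_pos hd)) n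
  have h2 := h1.mul_of_nonneg h1 (fun a => Finset.prod_nonneg fun i _ => h0' _)
    (fun a => Finset.prod_nonneg fun i _ => h0' _)
  refine Summable.of_norm_bounded (h2.mul_left C) fun a => ?_
  rw [norm_inner_T_toLp]
  have h := hC (ell d • (toReal a).1) (ell d • (toReal a).2)
  simp only [Finset.prod_inv_distrib]
  rw [← mul_inv, ← div_eq_mul_inv, le_div_iff₀ (mul_pos
    (Finset.prod_pos fun i _ => h0 _) (Finset.prod_pos fun i _ => h0 _)), mul_comm]
  refine le_trans (mul_le_mul_of_nonneg_right (le_abs_self _) (norm_nonneg _)) h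

/-! ### Traces of products with states -/

section Trace

open InnerProductSpace

section Abstract

variable {E ι κ : Type} [NormedAddCommGroup E] [InnerProductSpace ℂ E]

theorem hasSum_norm_inner_sq (e : HilbertBasis κ ℂ E) (w : E) :
    HasSum (fun i => ‖⟪w, e i⟫_ℂ‖ ^ 2) (‖w‖ ^ 2) := by
  have h := Complex.hasSum_re (e.hasSum_inner_mul_inner w w)
  rw [← inner_self_eq_norm_sq (𝕜 := ℂ)]
  refine h.congr_fun fun i => ?_
  rw [← inner_conj_symm (e i) w, Complex.mul_conj, Complex.ofReal_re, Complex.normSq_eq_norm_sq]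

theorem summable_norm_inner_sq (e : HilbertBasis κ ℂ E) {w : ι → E}
    (hw : Summable fun j => ‖w j‖ ^ 2) :
    Summable fun p : ι × κ => ‖⟪w p.1, e p.2⟫_ℂ‖ ^ 2 := by
  rw [summable_prod_of_nonneg fun p => sq_nonneg _]
  exact ⟨fun j => (hasSum_norm_inner_sq e (w j)).summable,
    hw.congr fun j => (hasSum_norm_inner_sq e (w j)).tsum_eq.symm⟩

theorem summable_rankOne [CompleteSpace E] {v : ι → E} (hv : Summable fun j => ‖v j‖ ^ 2) :
    Summable fun j => rankOne ℂ (v j) (v j) := by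
  refine Summable.of_norm (hv.congr fun j => ?_)
  rw [norm_rankOne, sq]

theorem hasSum_inner_rankOne {v : ι → E} {R : E →L[ℂ] E}
    (hR : HasSum (fun j => rankOne ℂ (v j) (v j)) R) (x y : E) :
    HasSum (fun j => ⟪x, v j⟫_ℂ * ⟪v j, y⟫_ℂ) ⟪x, R y⟫_ℂ := by
  have h := (hR.mapL (ContinuousLinearMap.apply ℂ E y)).mapL (innerSL ℂ x)
  simpa [inner_smul_right, mul_comm] using h

variable [CompleteSpace E]

/-- Both sums are iterated sums of the double family `⟨A* v_j, e_i⟩⟨e_i, v_j⟩`: summing over `i`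
first gives `⟨v_j, A v_j⟩` by Parseval, summing over `j` first gives `⟨e_i, ρ A e_i⟩`. The family is
absolutely summable because `xy ≤ x² + y²` and both factors are square-summable. -/
theorem exists_hasSum_inner_comp (e : HilbertBasis κ ℂ E) {v : ι → E} {ρ : E →L[ℂ] E}
    (hv : Summable fun j => ‖v j‖ ^ 2) (hρ : HasSum (fun j => rankOne ℂ (v j) (v j)) ρ)
    (A : E →L[ℂ] E) : ∃ t, HasSum (fun j => ⟪v j, A (v j)⟫_ℂ) t ∧
      HasSum (fun i => ⟪e i, (ρ ∘L A) (e i)⟫_ℂ) t := by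
  let A' := ContinuousLinearMap.adjoint A
  have hA : Summable fun j => ‖A' (v j)‖ ^ 2 := by
    refine Summable.of_nonneg_of_le (fun j => sq_nonneg _) (fun j => ?_) (hv.mul_left (‖A'‖ ^ 2))
    rw [← mul_pow]
    exact pow_le_pow_left₀ (norm_nonneg _) (A'.le_opNorm _) 2
  have hs : Summable fun p : ι × κ => ⟪A' (v p.1), e p.2⟫_ℂ * ⟪e p.2, v p.1⟫_ℂ := by
    refine Summable.of_norm_bounded
      ((summable_norm_inner_sq e hA).add (summable_norm_inner_sq e hv)) fun p => ?_
    rw [norm_mul, norm_inner_symm (e p.2)]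
    nlinarith [sq_nonneg (‖⟪A' (v p.1), e p.2⟫_ℂ‖ - ‖⟪v p.1, e p.2⟫_ℂ‖),
      sq_nonneg (‖⟪A' (v p.1), e p.2⟫_ℂ‖ + ‖⟪v p.1, e p.2⟫_ℂ‖)]
  refine ⟨_, hs.hasSum.prod_fiberwise fun j => ?_,
    ((Equiv.prodComm _ _).hasSum_iff.2 hs.hasSum).prod_fiberwise fun i => ?_⟩
  · have := e.hasSum_inner_mul_inner (A' (v j)) (v j)
    rwa [ContinuousLinearMap.adjoint_inner_left] at this
  · have h := hasSum_inner_rankOne hρ (e i) (A (e i))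
    refine h.congr_fun fun j => ?_
    simp [A', ContinuousLinearMap.adjoint_inner_left, mul_comm]

theorem exists_symmetric_sqrt {ρ : E →L[ℂ] E} (h : ρ.IsPositive) :
    ∃ B : E →L[ℂ] E, (∀ x y, ⟪B x, y⟫_ℂ = ⟪x, B y⟫_ℂ) ∧ ∀ x y, ⟪B x, B y⟫_ℂ = ⟪x, ρ y⟫_ℂ := by
  have h0 : 0 ≤ ρ := (ContinuousLinearMap.nonneg_iff_isPositive ρ).2 h
  have hB : CFC.sqrt ρ * CFC.sqrt ρ = ρ := CFC.sqrt_mul_sqrt_self ρ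
  have hB' : ∀ x y, ⟪CFC.sqrt ρ x, y⟫_ℂ = ⟪x, CFC.sqrt ρ y⟫_ℂ :=
    ((ContinuousLinearMap.nonneg_iff_isPositive _).1 (CFC.sqrt_nonneg ρ)).isSymmetric
  refine ⟨CFC.sqrt ρ, hB', fun x y => ?_⟩
  rw [hB']
  conv_rhs => rw [← hB]
  rfl

/-- A positive operator with finite trace is a norm-convergent sum of rank-one operators. -/
theorem exists_hasSum_rankOne (e : HilbertBasis κ ℂ E) {ρ : E →L[ℂ] E} (h : ρ.IsPositive)
    (hs : Summable fun i => ⟪e i, ρ (e i)⟫_ℂ) :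
    ∃ v : κ → E, (Summable fun j => ‖v j‖ ^ 2) ∧ HasSum (fun j => rankOne ℂ (v j) (v j)) ρ := by
  obtain ⟨B, hB, hBB⟩ := exists_symmetric_sqrt h
  have hv : Summable fun j => ‖B (e j)‖ ^ 2 := by
    refine (Complex.hasSum_re hs.hasSum).summable.congr fun j => ?_
    rw [← hBB, ← inner_self_eq_norm_sq (𝕜 := ℂ)]
    rfl
  -- With `B = √ρ`, the squares `‖B e_j‖² = ⟨e_j, ρ e_j⟩` sum to the trace, and Parseval for `⟨B x,
  -- B y⟩ = ⟨x, ρ y⟩` identifies the sum with `ρ`.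
  refine ⟨fun j => B (e j), hv, ?_⟩
  have hs := (summable_rankOne hv).hasSum
  convert hs using 1
  refine ContinuousLinearMap.ext fun y => ext_inner_left ℂ fun x => ?_
  refine HasSum.unique ?_ (hasSum_inner_rankOne hs x y)
  rw [← hBB]
  refine (e.hasSum_inner_mul_inner (B x) (B y)).congr_fun fun j => ?_
  rw [hB, hB]

end Abstract

theorem hasSum_trace_comp {n : ℕ} {ι : Type} {v : ι → Hilb n} {ρ : Hilb n →L[ℂ] Hilb n}
    (hv : Summable fun j => ‖v j‖ ^ 2) (hρ : HasSum (fun j => rankOne ℂ (v j) (v j)) ρ)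
    (A : Hilb n →L[ℂ] Hilb n) : HasSum (fun j => ⟪v j, A (v j)⟫_ℂ) (trace (ρ ∘L A)) := by
  obtain ⟨t, h1, h2⟩ := exists_hasSum_inner_comp (basis n) hv hρ A
  rw [trace, h2.tsum_eq]
  exact h1

theorem IsState.exists_hasSum_rankOne {n : ℕ} {ρ : Hilb n →L[ℂ] Hilb n} (h : IsState ρ) :
    ∃ v : basisIndex n → Hilb n, (Summable fun j => ‖v j‖ ^ 2) ∧
      HasSum (fun j => rankOne ℂ (v j) (v j)) ρ :=
  ZakGross.exists_hasSum_rankOne (basis n) h.1 (h.2 _ (basis n)).summable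

theorem norm_tensorVec {m k : ℕ} (f : Hilb m) (g : Hilb k) : ‖tensorVec f g‖ = ‖f‖ * ‖g‖ := by
  rw [← tensorMap_tmul, norm_tensorMap, TensorProduct.norm_tmul]

theorem ext_inner_tensorVec {m k : ℕ} {u v : Hilb (m + k)}
    (h : ∀ f g, ⟪tensorVec f g, u⟫_ℂ = ⟪tensorVec f g, v⟫_ℂ) : u = v := by
  refine Dense.eq_of_inner_right ℂ (denseRange_tensorMap m k) ?_
  rintro _ ⟨w, rfl⟩
  change ⟪tensorMap m k w, u⟫_ℂ = ⟪tensorMap m k w, v⟫_ℂ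
  induction w using TensorProduct.induction_on with
  | zero => simp
  | add w w' hw hw' => rw [map_add, inner_add_left, inner_add_left, hw, hw']
  | tmul f g => exact h f g

theorem summable_norm_tensorVec {m k : ℕ} {ι κ : Type} {v : ι → Hilb m} {w : κ → Hilb k}
    (hv : Summable fun j => ‖v j‖ ^ 2) (hw : Summable fun j => ‖w j‖ ^ 2) :
    Summable fun p : ι × κ => ‖tensorVec (v p.1) (w p.2)‖ ^ 2 := by
  simp only [norm_tensorVec, mul_pow]
  exact hv.mul_of_nonneg hw (fun _ => sq_nonneg _) (fun _ => sq_nonneg _)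

theorem hasSum_mul_prod {ι κ : Type} {f : ι → ℂ} {g : κ → ℂ} {s t : ℂ} (hf : HasSum f s)
    (hg : HasSum g t) : HasSum (fun p : ι × κ => f p.1 * g p.2) (s * t) :=
  hf.mul hg (summable_mul_of_summable_norm hf.summable.norm hg.summable.norm)

theorem hasSum_inner_tensorVec_tensorOp {m k : ℕ} {ι κ : Type} {v : ι → Hilb m} {w : κ → Hilb k}
    {ρ : Hilb m →L[ℂ] Hilb m} {σ : Hilb k →L[ℂ] Hilb k}
    (hρ : HasSum (fun j => rankOne ℂ (v j) (v j)) ρ)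
    (hσ : HasSum (fun j => rankOne ℂ (w j) (w j)) σ) (f f' : Hilb m) (g g' : Hilb k) :
    HasSum (fun p : ι × κ => ⟪tensorVec f' g', tensorVec (v p.1) (w p.2)⟫_ℂ *
        ⟪tensorVec (v p.1) (w p.2), tensorVec f g⟫_ℂ)
      (⟪tensorVec f' g', tensorOp ρ σ (tensorVec f g)⟫_ℂ) := by
  rw [tensorOp_tensorVec, inner_tensorVec]
  simp only [inner_tensorVec, mul_mul_mul_comm]
  exact (hasSum_mul_prod (hasSum_inner_rankOne hρ f' f) (hasSum_inner_rankOne hσ g' g) :)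

/-- Norm convergence is clear from `‖v ⊗ w‖ = ‖v‖ ‖w‖`. The limit is identified through its matrix
elements between product vectors, where both sides are products of two sums. -/
theorem hasSum_rankOne_tensorOp {m k : ℕ} {ι κ : Type} {v : ι → Hilb m} {w : κ → Hilb k}
    {ρ : Hilb m →L[ℂ] Hilb m} {σ : Hilb k →L[ℂ] Hilb k}
    (hv : Summable fun j => ‖v j‖ ^ 2) (hw : Summable fun j => ‖w j‖ ^ 2)
    (hρ : HasSum (fun j => rankOne ℂ (v j) (v j)) ρ)
    (hσ : HasSum (fun j => rankOne ℂ (w j) (w j)) σ) :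
    HasSum (fun p : ι × κ => rankOne ℂ (tensorVec (v p.1) (w p.2)) (tensorVec (v p.1) (w p.2)))
      (tensorOp ρ σ) := by
  have hs := summable_rankOne (summable_norm_tensorVec hv hw)
  have e : tensorOp ρ σ =
      ∑' p : ι × κ, rankOne ℂ (tensorVec (v p.1) (w p.2)) (tensorVec (v p.1) (w p.2)) :=
    clm_ext_tensorVec fun f g => ext_inner_tensorVec fun f' g' =>
      (hasSum_inner_tensorVec_tensorOp hρ hσ f f' g g').unique
        (hasSum_inner_rankOne hs.hasSum (tensorVec f' g') (tensorVec f g))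
  rw [e]
  exact hs.hasSum

/-- In the decomposition by the vectors `v_i ⊗ w_j` every term of the trace is a product, so the
double sum is the product of the two traces. -/
theorem trace_tensorOp_T {m k : ℕ} {ρ : Hilb m →L[ℂ] Hilb m} {σ : Hilb k →L[ℂ] Hilb k}
    (hρ : IsState ρ) (hσ : IsState σ) (d : ℕ) (a : Phase ℤ (m + k)) :
    trace (tensorOp ρ σ ∘L T d (toReal a)) =
      trace (ρ ∘L T d (toReal (fstModes a))) * trace (σ ∘L T d (toReal (sndModes a))) := by
  obtain ⟨v, hv, hv'⟩ := hρ.exists_hasSum_rankOne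
  obtain ⟨w, hw, hw'⟩ := hσ.exists_hasSum_rankOne
  have h := hasSum_trace_comp (summable_norm_tensorVec hv hw)
    (hasSum_rankOne_tensorOp hv hw hv' hw') (T d (toReal a))
  have h1 := hasSum_trace_comp hv hv' (T d (toReal (fstModes a)))
  have h2 := hasSum_trace_comp hw hw' (T d (toReal (sndModes a)))
  simp only [inner_tensorVec_T] at h
  exact h.unique (hasSum_mul_prod h1 h2 :)

end Trace

/-! ### Uniqueness of Fourier series -/

section Uniqueness

variable {X ι : Type} [MeasurableSpace X] [Fintype ι]

/-- Integration of a function on the torus, pulled back to `X`, against an integrable function. -/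
def pairingCLM {μ : Measure X} {ψ : X → UnitAddTorus ι} (hψ : Measurable ψ) {V : X → ℂ}
    (hV : Integrable V μ) : C(UnitAddTorus ι, ℂ) →L[ℂ] ℂ :=
  have hi : ∀ φ : C(UnitAddTorus ι, ℂ), Integrable (fun x => φ (ψ x) * V x) μ := fun φ =>
    hV.bdd_mul (c := ‖φ‖) (φ.continuous.measurable.comp hψ).aestronglyMeasurable
      (Eventually.of_forall fun x => φ.norm_coe_le_norm _)
  LinearMap.mkContinuous
    { toFun := fun φ => ∫ x, φ (ψ x) * V x ∂μ
      map_add' := fun φ φ' => by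
        rw [← integral_add (hi φ) (hi φ')]
        simp only [ContinuousMap.add_apply, add_mul]
      map_smul' := fun c φ => by
        rw [RingHom.id_apply, smul_eq_mul, ← integral_const_mul]
        simp only [ContinuousMap.smul_apply, smul_eq_mul, mul_assoc] }
    (∫ x, ‖V x‖ ∂μ) fun φ => by
      rw [mul_comm, ← integral_const_mul]
      refine norm_integral_le_of_norm_le (hV.norm.const_mul _) (Eventually.of_forall fun x => ?_)
      rw [norm_mul]
      exact mul_le_mul_of_nonneg_right (φ.norm_coe_le_norm _) (norm_nonneg _)

/-- The kernel of the continuous functional `pairingCLM` is closed and contains the monomials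
`mFourier c`, whose span is dense. -/
theorem integral_comp_torus_eq_zero {μ : Measure X} {ψ : X → UnitAddTorus ι} (hψ : Measurable ψ)
    {V : X → ℂ} (hV : Integrable V μ)
    (h : ∀ c, ∫ x, UnitAddTorus.mFourier c (ψ x) * V x ∂μ = 0) (φ : C(UnitAddTorus ι, ℂ)) :
    ∫ x, φ (ψ x) * V x ∂μ = 0 := by
  have hle : (Submodule.span ℂ (Set.range (UnitAddTorus.mFourier (d := ι)))).topologicalClosure ≤
      LinearMap.ker (pairingCLM hψ hV : C(UnitAddTorus ι, ℂ) →ₗ[ℂ] ℂ) := by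
    refine Submodule.topologicalClosure_minimal _ (Submodule.span_le.2 ?_)
      (pairingCLM hψ hV).isClosed_ker
    rintro _ ⟨c, rfl⟩
    exact h c
  rw [UnitAddTorus.span_mFourier_closure_eq_top] at hle
  exact hle (Submodule.mem_top (x := φ))

/-- The positive and the negative part of `Re V` are densities of two finite measures. Their images
on the torus integrate all continuous functions equally, hence coincide, and injectivity of `ψ` on
`C` carries this back to `X`. -/
theorem re_ae_eq_zero_of_fourier [StandardBorelSpace X] {μ : Measure X} {C : Set X}
    (hC : MeasurableSet C) {ψ : X → UnitAddTorus ι} (hψ : Measurable ψ) (hinj : Set.InjOn ψ C)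
    {V : X → ℂ} (hV : IntegrableOn V C μ)
    (h : ∀ c, ∫ x in C, UnitAddTorus.mFourier c (ψ x) * V x ∂μ = 0) :
    ∀ᵐ x ∂μ.restrict C, (V x).re = 0 := by
  set ν := μ.restrict C
  have hre : Integrable (fun x => (V x).re) ν := hV.re
  let P : Measure X := ν.withDensity fun x => ENNReal.ofReal (V x).re
  let P' : Measure X := ν.withDensity fun x => ENNReal.ofReal (-(V x).re)
  have fP : IsFiniteMeasure P := isFiniteMeasure_withDensity_ofReal hre.2
  have fP' : IsFiniteMeasure P' := isFiniteMeasure_withDensity_ofReal hre.neg.2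
  have hm : AEMeasurable (fun x => ENNReal.ofReal (V x).re) ν := hre.aemeasurable.ennreal_ofReal
  have hm' : AEMeasurable (fun x => ENNReal.ofReal (-(V x).re)) ν :=
    hre.neg.aemeasurable.ennreal_ofReal
  have key : P.map ψ = P'.map ψ := by
    refine ext_of_forall_integral_eq_of_IsFiniteMeasure fun φ => ?_
    rw [integral_map hψ.aemeasurable φ.continuous.aestronglyMeasurable,
      integral_map hψ.aemeasurable φ.continuous.aestronglyMeasurable,
      integral_withDensity_eq_integral_toReal_smul₀ hm (Eventually.of_forall fun x => by simp),
      integral_withDensity_eq_integral_toReal_smul₀ hm' (Eventually.of_forall fun x => by simp)]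
    have hφ : ∀ {u : X → ℝ}, Integrable u ν → Integrable (fun x => u x • φ (ψ x)) ν := fun hu =>
      hu.mul_bdd (c := ‖φ‖) (φ.continuous.measurable.comp hψ).aestronglyMeasurable
        (Eventually.of_forall fun x => φ.norm_coe_le_norm _)
    rw [← sub_eq_zero, ← integral_sub
      (hφ (u := fun x => (ENNReal.ofReal (V x).re).toReal) hre.real_toNNReal)
      (hφ (u := fun x => (ENNReal.ofReal (-(V x).re)).toReal) hre.neg.real_toNNReal)]
    -- A real test function suffices to compare the measures, and for it `Re ∫ φ V = ∫ φ Re V`.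
    let φ' : C(UnitAddTorus ι, ℂ) := ⟨fun z => (φ z : ℂ), by fun_prop⟩
    have h0 := congrArg Complex.re (integral_comp_torus_eq_zero hψ hV h φ')
    have hi : Integrable (fun x => φ' (ψ x) * V x) ν :=
      Integrable.bdd_mul (c := ‖φ'‖) hV (φ'.continuous.measurable.comp hψ).aestronglyMeasurable
        (Eventually.of_forall fun x => φ'.norm_coe_le_norm _)
    have h1 : ∫ x, RCLike.re (φ' (ψ x) * V x) ∂ν = 0 := by
      rw [integral_re hi]; exact h0
    rw [← h1]
    refine integral_congr_ae (Eventually.of_forall fun x => ?_)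
    have e : RCLike.re (φ' (ψ x) * V x) = φ (ψ x) * (V x).re := by
      simp [φ']
    simp only [e, smul_eq_mul]
    rcases le_total 0 (V x).re with hx | hx
    · rw [ENNReal.toReal_ofReal hx, ENNReal.ofReal_of_nonpos (neg_nonpos.2 hx)]; simp [mul_comm]
    · rw [ENNReal.toReal_ofReal (neg_nonneg.2 hx), ENNReal.ofReal_of_nonpos hx]; simp [mul_comm]
  have hPP : P = P' := by
    refine Measure.ext fun A hA => ?_
    have hAC := hA.inter hC
    -- Injective measurable images of Borel sets are Borel in standard Borel spaces. On `C`, the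
    -- preimage of `ψ '' (A ∩ C)` is `A` again, so the image measures determine the value on `A`.
    have hS : MeasurableSet (ψ '' (A ∩ C)) :=
      hAC.image_of_measurable_injOn hψ (hinj.mono Set.inter_subset_right)
    have e : ∀ {u : X → ENNReal}, ν.withDensity u (ψ ⁻¹' (ψ '' (A ∩ C))) = ν.withDensity u A := by
      intro u
      refine measure_congr ((withDensity_absolutelyContinuous ν u).ae_le ?_)
      filter_upwards [ae_restrict_mem hC] with x hx
      refine propext ⟨?_, fun hxA => ⟨x, ⟨hxA, hx⟩, rfl⟩⟩
      rintro ⟨y, ⟨hyA, hyC⟩, hy⟩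
      exact hinj hyC hx hy ▸ hyA
    have := congrArg (fun M : Measure (UnitAddTorus ι) => M (ψ '' (A ∩ C))) key
    simp only [Measure.map_apply hψ hS] at this
    rwa [e, e] at this
  have hlt : ∫⁻ x, ENNReal.ofReal (V x).re ∂ν ≠ ⊤ := by
    have := measure_lt_top P Set.univ
    rw [withDensity_apply _ MeasurableSet.univ, Measure.restrict_univ] at this
    exact this.ne
  filter_upwards [(withDensity_eq_iff hm hm' hlt).1 hPP] with x hx
  rcases le_total 0 (V x).re with h0 | h0
  · rw [ENNReal.ofReal_of_nonpos (neg_nonpos.2 h0), ENNReal.ofReal_eq_zero] at hx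
    exact le_antisymm hx h0
  · rw [ENNReal.ofReal_of_nonpos h0, eq_comm, ENNReal.ofReal_eq_zero] at hx
    linarith

/-- The imaginary part of `V` is minus the real part of `I * V`, whose coefficients vanish too. -/
theorem ae_eq_zero_of_fourier [StandardBorelSpace X] {μ : Measure X} {C : Set X}
    (hC : MeasurableSet C) {ψ : X → UnitAddTorus ι} (hψ : Measurable ψ) (hinj : Set.InjOn ψ C)
    {V : X → ℂ} (hV : IntegrableOn V C μ)
    (h : ∀ c, ∫ x in C, UnitAddTorus.mFourier c (ψ x) * V x ∂μ = 0) :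
    ∀ᵐ x ∂μ.restrict C, V x = 0 := by
  have h2 := re_ae_eq_zero_of_fourier hC hψ hinj (V := fun x => Complex.I * V x)
    (hV.const_mul _) fun c => by
      simp only [mul_left_comm _ Complex.I]
      rw [integral_const_mul, h c, mul_zero]
  filter_upwards [re_ae_eq_zero_of_fourier hC hψ hinj hV h, h2] with x h1 h2
  refine Complex.ext h1 ?_
  simpa using h2

end Uniqueness

/-! ### The cell as a fundamental domain of the torus -/

/-- The map of phase space onto the torus with fundamental domain `cell d n`. -/
def toTorus (d n : ℕ) (η : Phase ℝ n) : UnitAddTorus (Fin n ⊕ Fin n) :=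
  Sum.elim (fun i => ((η.1 i / (d * ell d) : ℝ) : UnitAddCircle))
    fun i => ((η.2 i / (d * ell d) : ℝ) : UnitAddCircle)

theorem measurable_toTorus (d n : ℕ) : Measurable (toTorus d n) := by
  refine measurable_pi_iff.2 fun j => ?_
  rcases j with i | i
  · exact AddCircle.measurable_mk'.comp
      (((measurable_pi_apply i).comp measurable_fst).div_const _)
  · exact AddCircle.measurable_mk'.comp
      (((measurable_pi_apply i).comp measurable_snd).div_const _)

theorem cell_side_pos {d : ℕ} (hd : 0 < d) : 0 < d * ell d := by
  have := ell_pos hd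
  positivity

theorem injOn_toTorus {d : ℕ} (hd : 0 < d) (n : ℕ) : Set.InjOn (toTorus d n) (cell d n) := by
  have hL := cell_side_pos hd
  have key : ∀ x y : ℝ, x ∈ Set.Ico 0 (d * ell d) → y ∈ Set.Ico 0 (d * ell d) →
      ((x / (d * ell d) : ℝ) : UnitAddCircle) = ((y / (d * ell d) : ℝ) : UnitAddCircle) →
      x = y := fun x y hx hy hxy => by
    have h := (AddCircle.coe_eq_coe_iff_of_mem_Ico (a := (0 : ℝ)) (p := 1)
      (x := x / (d * ell d)) (y := y / (d * ell d))
      ⟨div_nonneg hx.1 hL.le, by rw [zero_add, div_lt_one hL]; exact hx.2⟩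
      ⟨div_nonneg hy.1 hL.le, by rw [zero_add, div_lt_one hL]; exact hy.2⟩).1 hxy
    exact (div_left_inj' hL.ne').1 h
  intro η hη η' hη' h
  refine Prod.ext (funext fun i => ?_) (funext fun i => ?_)
  · exact key _ _ (hη.1 i) (hη'.1 i) (congrFun h (Sum.inl i))
  · exact key _ _ (hη.2 i) (hη'.2 i) (congrFun h (Sum.inr i))

/-- The box `[0, dℓ)ⁿ`. -/
def box (d n : ℕ) : Set (Fin n → ℝ) := Set.univ.pi fun _ => Set.Ico 0 (d * ell d)

theorem cell_eq_prod (d n : ℕ) : cell d n = box d n ×ˢ box d n := by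
  ext η
  simp [cell, box, Set.mem_pi]

theorem measurableSet_box (d n : ℕ) : MeasurableSet (box d n) :=
  MeasurableSet.univ_pi fun _ => measurableSet_Ico

theorem measurableSet_cell (d n : ℕ) : MeasurableSet (cell d n) := by
  rw [cell_eq_prod]
  exact (measurableSet_box d n).prod (measurableSet_box d n)

theorem ell_mul_eq {d : ℕ} (hd : 0 < d) (r : ℝ) :
    2 * Real.pi * (r / (d * ell d)) = ell d * r := by
  have h := ell_sq hd
  have := ell_pos hd
  field_simp
  linear_combination (-r) * h

/-- The character `exp(-iℓ[a, η])` of the lattice of Fourier modes. -/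
def latticeChar {n : ℕ} (d : ℕ) (a : Phase ℤ n) (η : Phase ℝ n) : ℂ :=
  Complex.exp (-(Complex.I * ((ell d * symp (toReal a) η : ℝ) : ℂ)))

/-- Since `2π / (dℓ) = ℓ`, the monomials of the rescaled torus are exactly the characters
`exp(-iℓ[a, η])`. The symplectic form exchanges the two blocks of `c` and causes the sign. -/
theorem mFourier_toTorus {d : ℕ} (hd : 0 < d) {n : ℕ} (c : Fin n ⊕ Fin n → ℤ) (η : Phase ℝ n) :
    UnitAddTorus.mFourier c (toTorus d n η) =
      latticeChar d (fun i => -c (Sum.inr i), fun i => c (Sum.inl i)) η := by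
  have h : UnitAddTorus.mFourier c (toTorus d n η) = ∏ j, fourier (c j) (toTorus d n η j) := rfl
  have hf : ∀ (k : ℤ) (r : ℝ), fourier k ((r / (d * ell d) : ℝ) : UnitAddCircle) =
      Complex.exp (Complex.I * ((ell d * (k * r) : ℝ) : ℂ)) := fun k r => by
    rw [fourier_coe_apply, mul_left_comm (ell d) (k : ℝ), ← ell_mul_eq hd r]
    congr 1
    push_cast
    ring
  rw [h, Fintype.prod_sum_type, latticeChar]
  simp only [toTorus, Sum.elim_inl, Sum.elim_inr, hf]
  rw [← Complex.exp_sum, ← Complex.exp_sum, ← Complex.exp_add, ← Finset.mul_sum, ← Finset.mul_sum,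
    ← mul_add, ← mul_neg]
  congr 2
  rw [← Complex.ofReal_sum, ← Complex.ofReal_sum, ← Complex.ofReal_add, ← Complex.ofReal_neg]
  congr 1
  simp only [symp, toReal, dotProduct, Int.cast_neg, neg_mul, Finset.sum_neg_distrib,
    ← Finset.mul_sum]
  ring

theorem norm_latticeChar {n : ℕ} (d : ℕ) (a : Phase ℤ n) (η : Phase ℝ n) :
    ‖latticeChar d a η‖ = 1 := by
  rw [latticeChar, ← mul_neg, ← Complex.ofReal_neg, norm_exp_I_mul]

theorem continuous_latticeChar {n : ℕ} (d : ℕ) (a : Phase ℤ n) : Continuous (latticeChar d a) := by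
  unfold latticeChar symp dotProduct
  fun_prop

theorem integrable_latticeChar_mul {n d : ℕ} (a : Phase ℤ n) {μ : Measure (Phase ℝ n)}
    {W : Phase ℝ n → ℂ} (hW : Integrable W μ) : Integrable (fun η => latticeChar d a η * W η) μ :=
  hW.bdd_mul (c := 1) (continuous_latticeChar d a).aestronglyMeasurable
    (Eventually.of_forall fun η => (norm_latticeChar d a η).le)

theorem HasWignerSeries.ae_eq {d : ℕ} (hd : 0 < d) {n : ℕ} {ρ : Hilb n →L[ℂ] Hilb n}
    {W W' : Phase ℝ n → ℂ} (h : HasWignerSeries d ρ W) (h' : HasWignerSeries d ρ W') :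
    W =ᵐ[volume.restrict (cell d n)] W' := by
  have h0 := ae_eq_zero_of_fourier (measurableSet_cell d n) (measurable_toTorus d n)
    (injOn_toTorus hd n) (V := fun η => W η - W' η) (h.1.sub h'.1) fun c => by
      simp only [mFourier_toTorus hd, mul_sub]
      rw [integral_sub (integrable_latticeChar_mul _ h.1) (integrable_latticeChar_mul _ h'.1),
        sub_eq_zero]
      exact (h.2 _).trans (h'.2 _).symm
  filter_upwards [h0] with η hη
  exact sub_eq_zero.1 hη

/-! ### Orthogonal series -/

/-- The lines spanned by the `z i` form an orthogonal family; zero vectors do no harm, as nothing is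
normalised. -/
theorem summable_of_orthogonal {E ι : Type} [NormedAddCommGroup E] [InnerProductSpace ℂ E]
    [CompleteSpace E] {z : ι → E} (hz : ∀ i j, i ≠ j → ⟪z i, z j⟫_ℂ = 0)
    (hs : Summable fun i => ‖z i‖ ^ 2) : Summable z := by
  have hV : OrthogonalFamily ℂ (fun i => Submodule.span ℂ {z i})
      fun i => (Submodule.span ℂ {z i}).subtypeₗᵢ :=
    OrthogonalFamily.of_pairwise fun i j hij => Submodule.isOrtho_span.2 fun u hu v hv => by
      rw [Set.mem_singleton_iff.1 hu, Set.mem_singleton_iff.1 hv]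
      exact hz i j hij
  exact (hV.summable_iff_norm_sq_summable
    fun i => ⟨z i, Submodule.mem_span_singleton_self _⟩).2 hs

theorem hasSum_inner_of_orthogonal {E ι : Type} [NormedAddCommGroup E] [InnerProductSpace ℂ E]
    {z z' : ι → E} {x x' : E} (hz : ∀ i j, i ≠ j → ⟪z i, z' j⟫_ℂ = 0) (hx : HasSum z x)
    (hx' : HasSum z' x') : HasSum (fun i => ⟪z i, z' i⟫_ℂ) ⟪x, x'⟫_ℂ := by
  have h1 : ∀ i, ⟪z i, x'⟫_ℂ = ⟪z i, z' i⟫_ℂ := fun i =>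
    (hx'.mapL (innerSL ℂ (z i))).unique (hasSum_single i fun j hj => hz i j hj.symm)
  have h2 := hx.mapL (innerSLFlip ℂ x')
  simpa only [innerSLFlip_apply_apply, h1] using h2

/-! ### Multiplication with functions of modulus one -/

theorem memLp_unimodular_mul {X : Type} [MeasurableSpace X] {μ : Measure X} {p : ENNReal}
    {c : X → ℂ} (hc : AEStronglyMeasurable c μ) (hc1 : ∀ x, ‖c x‖ = 1) {f : X → ℂ}
    (hf : MemLp f p μ) : MemLp (fun x => c x * f x) p μ := by
  refine hf.of_le_mul (c := 1) (hc.mul hf.1) (Eventually.of_forall fun x => ?_)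
  rw [norm_mul, hc1]

/-- Multiplication with a function of modulus one. -/
def unimodularMul {X : Type} [MeasurableSpace X] {μ : Measure X} (p : ENNReal) [Fact (1 ≤ p)]
    {c : X → ℂ} (hc : AEStronglyMeasurable c μ) (hc1 : ∀ x, ‖c x‖ = 1) :
    Lp ℂ p μ →L[ℂ] Lp ℂ p μ :=
  LinearMap.mkContinuous
    { toFun := fun f => (memLp_unimodular_mul hc hc1 (Lp.memLp f)).toLp _
      map_add' := fun f g => by
        rw [← MemLp.toLp_add, MemLp.toLp_eq_toLp_iff]
        filter_upwards [Lp.coeFn_add f g] with x hx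
        simp only [hx, Pi.add_apply, mul_add]
      map_smul' := fun r f => by
        rw [RingHom.id_apply, ← MemLp.toLp_const_smul, MemLp.toLp_eq_toLp_iff]
        filter_upwards [Lp.coeFn_smul r f] with x hx
        simp only [hx, Pi.smul_apply, smul_eq_mul]
        ring }
    1 fun f => by
      rw [one_mul]
      refine Lp.norm_le_norm_of_ae_le ?_
      filter_upwards [(memLp_unimodular_mul hc hc1 (Lp.memLp f)).coeFn_toLp] with x hx
      simp only [LinearMap.coe_mk, AddHom.coe_mk]
      rw [hx, norm_mul, hc1, one_mul]

theorem coeFn_unimodularMul {X : Type} [MeasurableSpace X] {μ : Measure X} (p : ENNReal)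
    [Fact (1 ≤ p)] {c : X → ℂ} (hc : AEStronglyMeasurable c μ) (hc1 : ∀ x, ‖c x‖ = 1)
    (f : Lp ℂ p μ) : unimodularMul p hc hc1 f =ᵐ[μ] fun x => c x * f x :=
  (memLp_unimodular_mul hc hc1 (Lp.memLp f)).coeFn_toLp

/-! ### Integrals over boxes -/

theorem ell_mul_cell_side {d : ℕ} (hd : 0 < d) : ell d * (d * ell d) = 2 * Real.pi := by
  rw [← ell_sq hd]; ring

/-- Since `ℓ · dℓ = 2π`, the interval contains a whole number of periods of each character. -/
theorem intervalIntegral_char {d : ℕ} (hd : 0 < d) (c : ℤ) :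
    ∫ p in Set.Ico 0 (d * ell d), Complex.exp (Complex.I * ((ell d * (c * p) : ℝ) : ℂ)) =
      if c = 0 then ((d * ell d : ℝ) : ℂ) else 0 := by
  have hL := cell_side_pos hd
  rw [integral_Ico_eq_integral_Ioc, ← intervalIntegral.integral_of_le hL.le]
  split_ifs with h
  · simp [h]
  · have hc : Complex.I * ((ell d * c : ℝ) : ℂ) ≠ 0 := by
      refine mul_ne_zero Complex.I_ne_zero (Complex.ofReal_ne_zero.2 (mul_ne_zero (ell_pos hd).ne' ?_))
      exact_mod_cast h
    have e : ∀ p : ℝ, Complex.I * ((ell d * (c * p) : ℝ) : ℂ) =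
        Complex.I * ((ell d * c : ℝ) : ℂ) * (p : ℂ) := fun p => by push_cast; ring
    simp only [e]
    rw [integral_exp_mul_complex hc, Complex.ofReal_zero, mul_zero, Complex.exp_zero]
    have e2 : Complex.I * ((ell d * c : ℝ) : ℂ) * ((d * ell d : ℝ) : ℂ) =
        c * (2 * Real.pi * Complex.I) := by
      have := congrArg (fun r : ℝ => (r : ℂ)) (ell_mul_cell_side hd)
      push_cast at this ⊢
      linear_combination (Complex.I * c) * this
    rw [e2, Complex.exp_int_mul_two_pi_mul_I, sub_self, zero_div]

theorem integral_box_char {d : ℕ} (hd : 0 < d) {n : ℕ} (c : Fin n → ℤ) :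
    ∫ p in box d n, Complex.exp (Complex.I * ((ell d * ((fun i => (c i : ℝ)) ⬝ᵥ p) : ℝ) : ℂ)) =
      if c = 0 then ((d * ell d : ℝ) : ℂ) ^ n else 0 := by
  have e : ∀ p : Fin n → ℝ,
      Complex.exp (Complex.I * ((ell d * ((fun i => (c i : ℝ)) ⬝ᵥ p) : ℝ) : ℂ)) =
        ∏ i, Complex.exp (Complex.I * ((ell d * (c i * p i) : ℝ) : ℂ)) := fun p => by
    rw [← Complex.exp_sum, dotProduct, Finset.mul_sum, Complex.ofReal_sum, Finset.mul_sum]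
  simp only [e]
  rw [box, volume_pi, Measure.restrict_pi_pi, integral_fintype_prod_eq_prod
    (f := fun i (x : ℝ) => Complex.exp (Complex.I * ((ell d * (c i * x) : ℝ) : ℂ)))]
  simp only [intervalIntegral_char hd]
  split_ifs with h
  · simp [h]
  · obtain ⟨i, hi⟩ := Function.ne_iff.1 h
    exact Finset.prod_eq_zero (Finset.mem_univ i) (if_neg hi)

/-! ### Lattice translates of the box -/

/-- The lattice vector `ℓu`. -/
def latticeVec {n : ℕ} (d : ℕ) (u : Fin n → ℤ) : Fin n → ℝ := fun i => ell d * u i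

/-- The residue class modulo `d` of an integer vector. -/
def residue {n : ℕ} (d : ℕ) (u : Fin n → ℤ) : Fin n → ZMod d := fun i => (u i : ZMod d)

theorem existsUnique_translate {d : ℕ} (hd : 0 < d) {n : ℕ} (w : Fin n → ℤ) (x : Fin n → ℝ) :
    ∃! k : Fin n → ℤ, x - latticeVec d (w + (d : ℤ) • k) ∈ box d n := by
  have h : ∀ i, ∃! k : ℤ, (x i - ell d * w i) - k • (d * ell d) ∈ Set.Ico 0 (0 + d * ell d) :=
    fun i => existsUnique_sub_zsmul_mem_Ico (cell_side_pos hd) _ 0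
  have e : ∀ (k : Fin n → ℤ) i, (x - latticeVec d (w + (d : ℤ) • k)) i =
      (x i - ell d * w i) - k i • (d * ell d) := fun k i => by
    change x i - ell d * ((w i + d * k i : ℤ) : ℝ) = x i - ell d * w i - k i • (d * ell d)
    rw [zsmul_eq_mul]
    push_cast
    ring
  choose k hk hk' using h
  refine ⟨k, Set.mem_univ_pi.2 fun i => ?_, fun k' h' => funext fun i => hk' i _ ?_⟩
  · rw [e]; simpa only [zero_add] using hk i
  · have := Set.mem_univ_pi.1 h' i
    rw [e] at this
    simpa only [zero_add] using this

/-- The box has side `dℓ`, so the translates by one residue class `w + dℤⁿ` already tile the space.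
-/
theorem hasSum_integral_translates {d : ℕ} (hd : 0 < d) {n : ℕ} (w : Fin n → ℤ)
    {h : (Fin n → ℝ) → ℂ} (hh : Integrable h) :
    HasSum (fun k : Fin n → ℤ => ∫ q in box d n, h (q + latticeVec d (w + (d : ℤ) • k)))
      (∫ x, h x) := by
  let S : (Fin n → ℤ) → Set (Fin n → ℝ) :=
    fun k => (fun x => x - latticeVec d (w + (d : ℤ) • k)) ⁻¹' box d n
  have hS : ∀ k, MeasurableSet (S k) := fun k =>
    (measurable_id.sub_const _) (measurableSet_box d n)
  have hU : ⋃ k, S k = Set.univ := Set.eq_univ_of_forall fun x =>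
    Set.mem_iUnion.2 (existsUnique_translate hd w x).exists
  have hD : Pairwise (Function.onFun Disjoint S) := fun k k' hkk' =>
    Set.disjoint_left.2 fun x hx hx' => hkk' ((existsUnique_translate hd w x).unique hx hx')
  have key := hasSum_integral_iUnion hS hD (hh.integrableOn (s := ⋃ k, S k))
  rw [hU, Measure.restrict_univ] at key
  refine key.congr_fun fun k => ?_
  have := (measurePreserving_sub_right volume
    (latticeVec d (w + (d : ℤ) • k))).setIntegral_preimage_emb
    (measurableEmbedding_subRight _) (fun q => h (q + latticeVec d (w + (d : ℤ) • k))) (box d n)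
  rw [← this]
  simp only [sub_add_cancel]
  rfl

theorem hasSum_integral_residue {d : ℕ} (hd : 0 < d) {n : ℕ} (s : Fin n → ZMod d)
    {h : (Fin n → ℝ) → ℂ} (hh : Integrable h) :
    HasSum (fun u : Fin n → ℤ => if residue d u = s then
      ∫ q in box d n, h (q + latticeVec d u) else 0) (∫ x, h x) := by
  have hs : ∀ i, ∃ w : ℤ, (w : ZMod d) = s i := fun i => ZMod.intCast_surjective (s i)
  choose w hw using hs
  have hr : ∀ k : Fin n → ℤ, residue d (w + (d : ℤ) • k) = s := fun k => funext fun i => by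
    simp [residue, hw]
  have hinj : Function.Injective fun k : Fin n → ℤ => w + (d : ℤ) • k := fun k k' hk => by
    refine funext fun i => ?_
    have := congrFun hk i
    simp only [Pi.add_apply, Pi.smul_apply, smul_eq_mul, add_right_inj] at this
    exact mul_left_cancel₀ (by exact_mod_cast hd.ne') this
  refine (hinj.hasSum_iff fun u hu => if_neg fun hus => hu ?_).1
    ((hasSum_integral_translates hd w hh).congr_fun fun k => ?_)
  · have hdv : ∀ i, (d : ℤ) ∣ u i - w i := fun i =>
      (ZMod.intCast_eq_intCast_iff_dvd_sub _ _ d).1 ((hw i).trans (congrFun hus i).symm)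
    choose k hk using hdv
    refine ⟨k, funext fun i => ?_⟩
    have := hk i
    simp only [Pi.add_apply, Pi.smul_apply, smul_eq_mul]
    linarith
  · simp only [Function.comp_apply, hr, if_true]

/-! ### The Zak transform -/

/-- The character `exp(iℓ u · x)`. -/
def freqChar {n : ℕ} (d : ℕ) (u : Fin n → ℤ) (x : Fin n → ℝ) : ℂ :=
  Complex.exp (Complex.I * ((ell d * ((fun i => (u i : ℝ)) ⬝ᵥ x) : ℝ) : ℂ))

section FreqChar

variable {n : ℕ} (d : ℕ) (u w : Fin n → ℤ) (x y : Fin n → ℝ)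

theorem freqChar_add_left : freqChar d (u + w) x = freqChar d u x * freqChar d w x := by
  have h : (fun i => ((u + w) i : ℝ)) = (fun i => (u i : ℝ)) + fun i => (w i : ℝ) :=
    funext fun i => by simp
  rw [freqChar, freqChar, freqChar, ← Complex.exp_add, h, add_dotProduct, ← mul_add,
    ← Complex.ofReal_add, mul_add]

theorem freqChar_add_right : freqChar d u (x + y) = freqChar d u x * freqChar d u y := by
  rw [freqChar, freqChar, freqChar, ← Complex.exp_add, dotProduct_add, ← mul_add,
    ← Complex.ofReal_add, mul_add]

theorem freqChar_zero_right : freqChar d u 0 = 1 := by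
  simp [freqChar]

theorem norm_freqChar : ‖freqChar d u x‖ = 1 := norm_exp_I_mul _

theorem conj_freqChar : (starRingEnd ℂ) (freqChar d u x) = freqChar d (-u) x := by
  have h : (fun i => ((-u) i : ℝ)) = -fun i => (u i : ℝ) := funext fun i => by simp
  rw [freqChar, freqChar, ← Complex.exp_conj, h, neg_dotProduct, map_mul, Complex.conj_I,
    Complex.conj_ofReal, mul_neg, Complex.ofReal_neg, mul_neg, neg_mul]

theorem continuous_freqChar : Continuous (freqChar d u) := by
  unfold freqChar dotProduct
  fun_prop

theorem latticeChar_eq_freqChar (a : Phase ℤ n) (η : Phase ℝ n) :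
    latticeChar d a η = freqChar d (-a.1) η.2 * freqChar d a.2 η.1 := by
  have h : (fun i => ((-a.1) i : ℝ)) = -fun i => (a.1 i : ℝ) := funext fun i => by simp
  rw [latticeChar, freqChar, freqChar, ← Complex.exp_add, h, neg_dotProduct, ← mul_add,
    ← Complex.ofReal_add, ← mul_neg, ← Complex.ofReal_neg, symp]
  congr 3
  simp only [toReal]
  ring

end FreqChar

theorem restrict_cell (d n : ℕ) : (volume : Measure (Phase ℝ n)).restrict (cell d n) =
    ((volume : Measure (Fin n → ℝ)).restrict (box d n)).prod (volume.restrict (box d n)) := by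
  rw [cell_eq_prod, Measure.prod_restrict, Measure.volume_eq_prod]

theorem volume_box_lt_top (d n : ℕ) : volume (box d n) < ⊤ := by
  rw [box, Real.volume_pi_Ico]
  exact ENNReal.prod_lt_top fun i _ => ENNReal.ofReal_lt_top

instance isFiniteMeasure_box (d n : ℕ) :
    IsFiniteMeasure ((volume : Measure (Fin n → ℝ)).restrict (box d n)) :=
  ⟨by rw [Measure.restrict_apply_univ]; exact volume_box_lt_top d n⟩

instance isFiniteMeasure_cell (d n : ℕ) :
    IsFiniteMeasure ((volume : Measure (Phase ℝ n)).restrict (cell d n)) := by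
  rw [restrict_cell]; infer_instance

/-- Carries almost-everywhere statements about wave functions over to the terms of the Zak transform
on the cell. -/
theorem quasi_translate {d n : ℕ} (u : Fin n → ℤ) : Measure.QuasiMeasurePreserving
    (fun η : Phase ℝ n => η.1 + latticeVec d u) (volume.restrict (cell d n)) volume := by
  rw [restrict_cell]
  exact (measurePreserving_add_right volume (latticeVec d u)).quasiMeasurePreserving.comp
    ((Measure.quasiMeasurePreserving_fst).mono_right Measure.restrict_le_self.absolutelyContinuous)

theorem memLp_zakTerm {n : ℕ} (d : ℕ) (f : Hilb n) (u : Fin n → ℤ) :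
    MemLp (fun η : Phase ℝ n => freqChar d (-u) η.2 * f (η.1 + latticeVec d u)) 2
      (volume.restrict (cell d n)) := by
  refine memLp_unimodular_mul ((continuous_freqChar d (-u)).comp
    continuous_snd).aestronglyMeasurable (fun η => norm_freqChar d _ _) ?_
  rw [restrict_cell]
  exact MemLp.comp_fst (((Lp.memLp f).comp_measurePreserving
    (measurePreserving_add_right volume (latticeVec d u))).restrict (box d n)) _

/-- The term `exp(-iℓ u · p) f(q + ℓu)` of the Zak transform of `f`. -/
def zakTerm {n : ℕ} (d : ℕ) (f : Hilb n) (u : Fin n → ℤ) :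
    Lp ℂ 2 ((volume : Measure (Phase ℝ n)).restrict (cell d n)) := (memLp_zakTerm d f u).toLp _

theorem coeFn_zakTerm {n : ℕ} (d : ℕ) (f : Hilb n) (u : Fin n → ℤ) :
    zakTerm d f u =ᵐ[volume.restrict (cell d n)]
      fun η => freqChar d (-u) η.2 * f (η.1 + latticeVec d u) :=
  (memLp_zakTerm d f u).coeFn_toLp

/-- The integral over `p` vanishes unless `u = w`, by orthogonality of characters on the box. On the
diagonal it contributes the volume `(dℓ)ⁿ`. -/
theorem inner_zakTerm {d : ℕ} (hd : 0 < d) {n : ℕ} (f g : Hilb n) (u w : Fin n → ℤ) :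
    ⟪zakTerm d f u, zakTerm d g w⟫_ℂ = if u = w then ((d * ell d : ℝ) : ℂ) ^ n *
      ∫ q in box d n, ⟪f (q + latticeVec d u), g (q + latticeVec d u)⟫_ℂ else 0 := by
  have h : ⟪zakTerm d f u, zakTerm d g w⟫_ℂ = ∫ η : Phase ℝ n in cell d n,
      ⟪f (η.1 + latticeVec d u), g (η.1 + latticeVec d w)⟫_ℂ * freqChar d (u - w) η.2 := by
    rw [L2.inner_def]
    refine integral_congr_ae ?_
    filter_upwards [coeFn_zakTerm d f u, coeFn_zakTerm d g w] with η h1 h2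
    rw [h1, h2, RCLike.inner_apply, RCLike.inner_apply, map_mul, conj_freqChar, neg_neg,
      sub_eq_add_neg, freqChar_add_left]
    ring
  rw [h, restrict_cell, integral_prod_mul
    (fun q => ⟪f (q + latticeVec d u), g (q + latticeVec d w)⟫_ℂ) (freqChar d (u - w))]
  simp only [freqChar]
  rw [integral_box_char hd (u - w)]
  simp only [sub_eq_zero]
  split_ifs with huw
  · rw [huw, mul_comm]
  · rw [mul_zero]

theorem hasSum_inner_zakTerm_residue {d : ℕ} (hd : 0 < d) {n : ℕ} (f g : Hilb n)
    (s : Fin n → ZMod d) :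
    HasSum (fun u => if residue d u = s then ⟪zakTerm d f u, zakTerm d g u⟫_ℂ else 0)
      (((d * ell d : ℝ) : ℂ) ^ n * ⟪f, g⟫_ℂ) := by
  have h := (hasSum_integral_residue hd s (h := fun x => ⟪f x, g x⟫_ℂ)
    (L2.integrable_inner f g)).mul_left (((d * ell d : ℝ) : ℂ) ^ n)
  rw [L2.inner_def]
  refine h.congr_fun fun u => ?_
  rw [inner_zakTerm hd, if_pos rfl, mul_ite, mul_zero]

theorem summable_norm_sq_zakTerm {d : ℕ} (hd : 0 < d) {n : ℕ} (f : Hilb n) :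
    Summable fun u => ‖zakTerm d f u‖ ^ 2 := by
  have : NeZero d := ⟨hd.ne'⟩
  -- Every `u` lies in exactly one of the finitely many residue classes, so adding the series of all
  -- classes gives the full series.
  have h := summable_sum fun (s : Fin n → ZMod d) (_ : s ∈ Finset.univ) =>
    (hasSum_inner_zakTerm_residue hd f f s).summable
  simp only [Finset.sum_ite_eq, Finset.mem_univ, if_true] at h
  refine (Complex.hasSum_re h.hasSum).summable.congr fun u => ?_
  exact inner_self_eq_norm_sq (𝕜 := ℂ) (zakTerm d f u)

/-- The Zak transform `∑_u c(u) exp(-iℓ u · p) f(q + ℓu)` with coefficients `c`. -/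
def zak {n : ℕ} (d : ℕ) (c : (Fin n → ℤ) → ℂ) (f : Hilb n) :
    Lp ℂ 2 ((volume : Measure (Phase ℝ n)).restrict (cell d n)) := ∑' u, c u • zakTerm d f u

theorem hasSum_zak {d : ℕ} (hd : 0 < d) {n : ℕ} {c : (Fin n → ℤ) → ℂ} (hc : ∀ u, ‖c u‖ ≤ 1)
    (f : Hilb n) : HasSum (fun u => c u • zakTerm d f u) (zak d c f) := by
  refine (summable_of_orthogonal (fun u w huw => ?_) ?_).hasSum
  · rw [inner_smul_left, inner_smul_right, inner_zakTerm hd, if_neg huw, mul_zero, mul_zero]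
  · refine Summable.of_nonneg_of_le (fun u => sq_nonneg _) (fun u => ?_)
      (summable_norm_sq_zakTerm hd f)
    rw [norm_smul]
    exact pow_le_pow_left₀ (by positivity)
      (mul_le_of_le_one_left (norm_nonneg _) (hc u)) 2

theorem hasSum_inner_zak {d : ℕ} (hd : 0 < d) {n : ℕ} {c c' : (Fin n → ℤ) → ℂ}
    (hc : ∀ u, ‖c u‖ ≤ 1) (hc' : ∀ u, ‖c' u‖ ≤ 1) (f g : Hilb n) :
    HasSum (fun u => (starRingEnd ℂ) (c u) * c' u * ⟪zakTerm d f u, zakTerm d g u⟫_ℂ)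
      ⟪zak d c f, zak d c' g⟫_ℂ := by
  refine (hasSum_inner_of_orthogonal (fun u w huw => ?_) (hasSum_zak hd hc f)
    (hasSum_zak hd hc' g)).congr_fun fun u => ?_
  · rw [inner_smul_left, inner_smul_right, inner_zakTerm hd, if_neg huw, mul_zero, mul_zero]
  · rw [inner_smul_left, inner_smul_right, mul_assoc]

/-- Multiplication with a character of the lattice of Fourier modes. -/
def latticeMul {n : ℕ} (d : ℕ) (p : ENNReal) [Fact (1 ≤ p)] (a : Phase ℤ n) :
    Lp ℂ p ((volume : Measure (Phase ℝ n)).restrict (cell d n)) →L[ℂ]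
      Lp ℂ p ((volume : Measure (Phase ℝ n)).restrict (cell d n)) :=
  unimodularMul p (continuous_latticeChar d a).aestronglyMeasurable (norm_latticeChar d a)

theorem coeFn_latticeMul {n : ℕ} (d : ℕ) (p : ENNReal) [Fact (1 ≤ p)] (a : Phase ℤ n)
    (F : Lp ℂ p ((volume : Measure (Phase ℝ n)).restrict (cell d n))) :
    latticeMul d p a F =ᵐ[volume.restrict (cell d n)] fun η => latticeChar d a η * F η :=
  coeFn_unimodularMul p _ _ F

/-- The displacement `exp(-iℓ a_X · p̂) exp(iℓ a_Z · q̂)`. -/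
def displace {n : ℕ} (d : ℕ) (a : Phase ℤ n) (f : Hilb n) : Hilb n :=
  translation (ell d • (toReal a).1) (modulation (ell d • (toReal a).2) f)

theorem coeFn_displace {n : ℕ} (d : ℕ) (a : Phase ℤ n) (f : Hilb n) :
    displace d a f =ᵐ[volume] fun x =>
      freqChar d a.2 (x - latticeVec d a.1) * f (x - latticeVec d a.1) := by
  filter_upwards [coeFn_translation_modulation (ell d • (toReal a).1) (ell d • (toReal a).2) f]
    with x hx
  rw [displace, hx, smul_dotProduct]
  rfl

theorem latticeVec_add {n : ℕ} (d : ℕ) (u w : Fin n → ℤ) :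
    latticeVec d (u + w) = latticeVec d u + latticeVec d w :=
  funext fun i => by simp [latticeVec, mul_add]

theorem latticeVec_neg {n : ℕ} (d : ℕ) (u : Fin n → ℤ) : latticeVec d (-u) = -latticeVec d u :=
  funext fun i => by simp [latticeVec]

/-- The factor `exp(-iℓ a_X · p)` moves the index by `a_X`, and `exp(iℓ a_Z · q)` is the modulation
of `f` up to its constant value at the lattice point. Multiplication by a character is thus a
displacement of `f`. -/
theorem latticeMul_zakTerm {n : ℕ} (d : ℕ) (a : Phase ℤ n) (f : Hilb n) (w : Fin n → ℤ) :
    latticeMul d 2 a (zakTerm d f w) =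
      freqChar d a.2 (latticeVec d (-w)) • zakTerm d (displace d a f) (w + a.1) := by
  refine Lp.ext ?_
  filter_upwards [coeFn_latticeMul d 2 a (zakTerm d f w), coeFn_zakTerm d f w,
    Lp.coeFn_smul (freqChar d a.2 (latticeVec d (-w))) (zakTerm d (displace d a f) (w + a.1)),
    coeFn_zakTerm d (displace d a f) (w + a.1),
    (quasi_translate (d := d) (w + a.1)).ae (coeFn_displace d a f)] with η h1 h2 h3 h4 h5
  rw [h1, h2, h3, Pi.smul_apply, h4, h5, latticeChar_eq_freqChar, smul_eq_mul, latticeVec_add,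
    ← add_assoc, add_sub_cancel_right, freqChar_add_right d a.2 η.1, neg_add, freqChar_add_left]
  have h : freqChar d a.2 (latticeVec d (-w)) * freqChar d a.2 (latticeVec d w) = 1 := by
    rw [← freqChar_add_right, latticeVec_neg, neg_add_cancel, freqChar_zero_right]
  linear_combination (-freqChar d (-a.1) η.2 * freqChar d a.2 η.1 * freqChar d (-w) η.2 *
    f (η.1 + latticeVec d w)) * h

theorem latticeMul_zak {d : ℕ} (hd : 0 < d) {n : ℕ} (a : Phase ℤ n) {c : (Fin n → ℤ) → ℂ}
    (hc : ∀ u, ‖c u‖ ≤ 1) (f : Hilb n) :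
    latticeMul d 2 a (zak d c f) =
      zak d (fun u => freqChar d a.2 (latticeVec d (a.1 - u)) * c (u - a.1)) (displace d a f) := by
  have h1 := (hasSum_zak hd hc f).mapL (latticeMul d 2 a)
  have h2 := hasSum_zak hd (c := fun u => freqChar d a.2 (latticeVec d (a.1 - u)) * c (u - a.1))
    (fun u => by rw [norm_mul, norm_freqChar, one_mul]; exact hc _) (displace d a f)
  refine h1.unique (((Equiv.addRight a.1).hasSum_iff.2 h2).congr_fun fun w => ?_)
  simp only [Function.comp_apply, Equiv.coe_addRight, add_sub_cancel_right, map_smul,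
    latticeMul_zakTerm, smul_smul]
  rw [mul_comm, sub_add_cancel_right]

/-! ### The Wigner function of a vector -/

/-- The indicator function of a residue class modulo `d`. -/
def classIndicator {n d : ℕ} (s : Fin n → ZMod d) (u : Fin n → ℤ) : ℂ :=
  if residue d u = s then 1 else 0

theorem norm_classIndicator_le {n d : ℕ} (s : Fin n → ZMod d) (u : Fin n → ℤ) :
    ‖classIndicator s u‖ ≤ 1 := by
  rw [classIndicator]
  split_ifs <;> simp

/-- One residue class suffices to recover the whole inner product, because its translates of the box
tile the space. -/
theorem inner_zak_classIndicator {d : ℕ} (hd : 0 < d) {n : ℕ} (s : Fin n → ZMod d) (f g : Hilb n) :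
    ⟪zak d (classIndicator s) f, zak d (classIndicator s) g⟫_ℂ =
      ((d * ell d : ℝ) : ℂ) ^ n * ⟪f, g⟫_ℂ := by
  refine (hasSum_inner_zak hd (norm_classIndicator_le s) (norm_classIndicator_le s) f g).unique
    ((hasSum_inner_zakTerm_residue hd f g s).congr_fun fun u => ?_)
  rw [classIndicator]
  split_ifs <;> simp

theorem norm_sq_zak_classIndicator {d : ℕ} (hd : 0 < d) {n : ℕ} (s : Fin n → ZMod d) (f : Hilb n) :
    ‖zak d (classIndicator s) f‖ ^ 2 = (d * ell d) ^ n * ‖f‖ ^ 2 := by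
  have h := inner_zak_classIndicator hd s f f
  rw [inner_self_eq_norm_sq_to_K, inner_self_eq_norm_sq_to_K] at h
  refine Complex.ofReal_injective ?_
  rw [Complex.ofReal_mul, Complex.ofReal_pow, Complex.ofReal_pow, Complex.ofReal_pow]
  exact h

theorem exists_eq_add_of_residue_eq {d n : ℕ} {u w : Fin n → ℤ} (h : residue d u = residue d w) :
    ∃ j : Fin n → ℤ, u = w + (d : ℤ) • j := by
  have hdv : ∀ i, (d : ℤ) ∣ u i - w i := fun i =>
    (ZMod.intCast_eq_intCast_iff_dvd_sub _ _ d).1 (congrFun h i).symm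
  choose j hj using hdv
  refine ⟨j, funext fun i => ?_⟩
  have := hj i
  change u i = w i + d * j i
  linarith

theorem freqChar_latticeVec {d : ℕ} (hd : 0 < d) {n : ℕ} (u w : Fin n → ℤ) :
    freqChar d u (latticeVec d w) =
      Complex.exp (Complex.I * ((2 * Real.pi * ((u ⬝ᵥ w : ℤ) : ℝ) / d : ℝ) : ℂ)) := by
  rw [freqChar]
  congr 3
  have h : (fun i => (u i : ℝ)) ⬝ᵥ latticeVec d w = ell d * ((u ⬝ᵥ w : ℤ) : ℝ) := by
    simp only [dotProduct, latticeVec, Finset.mul_sum, Int.cast_sum, Int.cast_mul]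
    exact Finset.sum_congr rfl fun i _ => by ring
  rw [h, ← ell_sq hd]
  field_simp

theorem exp_eq_of_sub_eq_int {x y : ℝ} (k : ℤ) (h : x - y = 2 * Real.pi * k) :
    Complex.exp (Complex.I * (x : ℂ)) = Complex.exp (Complex.I * (y : ℂ)) := by
  have : Complex.I * (x : ℂ) = Complex.I * (y : ℂ) + k * (2 * Real.pi * Complex.I) := by
    have h' := congrArg (fun r : ℝ => (r : ℂ)) h
    push_cast at h'
    linear_combination Complex.I * h'
  rw [this, Complex.exp_add, Complex.exp_int_mul_two_pi_mul_I, mul_one]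

theorem int_cast_dotProduct {n : ℕ} (u w : Fin n → ℤ) :
    (fun i => (u i : ℝ)) ⬝ᵥ (fun i => (w i : ℝ)) = ((u ⬝ᵥ w : ℤ) : ℝ) := by
  simp [dotProduct]

/-- With `d = 2r + 1`, the phase `-2πr (a_X · a_Z) / d` equals `π (1 + 1/d) (a_X · a_Z)` modulo
`2π`. It does not depend on `j`, so it is constant on the residue class and can be taken out of the
sum. -/
theorem freqChar_half {r n : ℕ} (a : Phase ℤ n) (j : Fin n → ℤ) :
    freqChar (2 * r + 1) a.2 (latticeVec (2 * r + 1)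
        (a.1 - (((r : ℤ) + 1) • a.1 + ((2 * r + 1 : ℕ) : ℤ) • j))) =
      Complex.exp (Complex.I * ((Real.pi * ((toReal a).1 ⬝ᵥ (toReal a).2) : ℝ) : ℂ)) *
        Complex.exp (Complex.I *
          ((Real.pi * ((toReal a).1 ⬝ᵥ (toReal a).2) / (2 * r + 1 : ℕ) : ℝ) : ℂ)) := by
  rw [freqChar_latticeVec (Nat.succ_pos _), ← Complex.exp_add, ← mul_add, ← Complex.ofReal_add]
  simp only [toReal]
  rw [int_cast_dotProduct]
  refine exp_eq_of_sub_eq_int (-(a.1 ⬝ᵥ a.2) - a.2 ⬝ᵥ j) ?_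
  rw [dotProduct_sub, dotProduct_add, dotProduct_smul, dotProduct_smul, dotProduct_comm a.2 a.1]
  have h : (2 * (r : ℝ) + 1) ≠ 0 := by positivity
  simp only [smul_eq_mul]
  push_cast
  field_simp
  ring

/-- The equation says `2s = w`, and `r + 1` is the inverse of `2` modulo `2r + 1`. Oddness of `d`
enters here and in `freqChar_half`. -/
theorem two_mul_eq_iff {r n : ℕ} (s : Fin n → ZMod (2 * r + 1)) (w : Fin n → ℤ) :
    s - residue (2 * r + 1) w = -s ↔ s = residue (2 * r + 1) (((r : ℤ) + 1) • w) := by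
  have h0 : (2 * (r : ZMod (2 * r + 1)) + 1) = 0 := by
    exact_mod_cast ZMod.natCast_self (2 * r + 1)
  have h1 : residue (2 * r + 1) (((r : ℤ) + 1) • w) =
      fun i => ((r : ZMod (2 * r + 1)) + 1) * (w i : ZMod (2 * r + 1)) := funext fun i => by
    simp [residue]
  rw [h1]
  constructor
  · intro h
    funext i
    have hi : s i - (w i : ZMod (2 * r + 1)) = -s i := congrFun h i
    linear_combination (r + 1 : ZMod (2 * r + 1)) * hi - s i * h0
  · rintro rfl
    funext i
    change ((r : ZMod (2 * r + 1)) + 1) * (w i : ZMod (2 * r + 1)) - (w i : ZMod (2 * r + 1)) =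
      -(((r : ZMod (2 * r + 1)) + 1) * (w i : ZMod (2 * r + 1)))
    linear_combination (w i : ZMod (2 * r + 1)) * h0

theorem inner_T_eq_displace {n : ℕ} (d : ℕ) (a : Phase ℤ n) (f g : Hilb n) :
    ⟪f, T d (toReal a) g⟫_ℂ =
      Complex.exp (Complex.I * ((Real.pi * ((toReal a).1 ⬝ᵥ (toReal a).2) / d : ℝ) : ℂ)) *
        ⟪f, displace d a g⟫_ℂ := by
  rw [T_apply, inner_smul_right]
  rfl

/-- Multiplication by the character moves the class `-s` to `a_X - s`, which meets `s` only if `2s =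
a_X`. For this one class the constant phase is `exp(iπ a_X·a_Z)` times the prefactor of `T_a`, and
what remains is `(dℓ)ⁿ` times the matrix element of the displacement. -/
theorem sum_inner_zak {d : ℕ} (hd : Odd d) [NeZero d] {n : ℕ} (a : Phase ℤ n) (f : Hilb n) :
    ∑ s : Fin n → ZMod d, ⟪zak d (classIndicator s) f,
        latticeMul d 2 a (zak d (classIndicator (-s)) f)⟫_ℂ =
      ((d * ell d : ℝ) : ℂ) ^ n *
        (Complex.exp (Complex.I * ((Real.pi * ((toReal a).1 ⬝ᵥ (toReal a).2) : ℝ) : ℂ)) *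
          ⟪f, T d (toReal a) f⟫_ℂ) := by
  obtain ⟨r, rfl⟩ := hd
  have hd : 0 < 2 * r + 1 := Nat.succ_pos _
  have key : ∀ s : Fin n → ZMod (2 * r + 1), ∀ u, (starRingEnd ℂ) (classIndicator s u) *
      (freqChar (2 * r + 1) a.2 (latticeVec (2 * r + 1) (a.1 - u)) *
        classIndicator (-s) (u - a.1)) =
      if s = residue (2 * r + 1) (((r : ℤ) + 1) • a.1) then (if residue (2 * r + 1) u = s then
        Complex.exp (Complex.I * ((Real.pi * ((toReal a).1 ⬝ᵥ (toReal a).2) : ℝ) : ℂ)) *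
          Complex.exp (Complex.I *
            ((Real.pi * ((toReal a).1 ⬝ᵥ (toReal a).2) / (2 * r + 1 : ℕ) : ℝ) : ℂ))
        else 0) else 0 := fun s u => by
    by_cases hu : residue (2 * r + 1) u = s
    · have hsub : residue (2 * r + 1) (u - a.1) = s - residue (2 * r + 1) a.1 := by
        rw [← hu]
        exact funext fun i => by simp [residue]
      rw [classIndicator, classIndicator, if_pos hu, if_pos hu, hsub, map_one, one_mul]
      simp only [two_mul_eq_iff]
      split_ifs with hs
      · obtain ⟨j, rfl⟩ := exists_eq_add_of_residue_eq (hu.trans hs)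
        rw [mul_one, freqChar_half]
      · rw [mul_zero]
    · rw [classIndicator, if_neg hu, if_neg hu, ite_self, map_zero, zero_mul]
  have hval : ∀ s : Fin n → ZMod (2 * r + 1), ⟪zak (2 * r + 1) (classIndicator s) f,
      latticeMul (2 * r + 1) 2 a (zak (2 * r + 1) (classIndicator (-s)) f)⟫_ℂ =
      if s = residue (2 * r + 1) (((r : ℤ) + 1) • a.1) then
        (((2 * r + 1 : ℕ) * ell (2 * r + 1) : ℝ) : ℂ) ^ n *
        (Complex.exp (Complex.I * ((Real.pi * ((toReal a).1 ⬝ᵥ (toReal a).2) : ℝ) : ℂ)) *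
          ⟪f, T (2 * r + 1) (toReal a) f⟫_ℂ) else 0 := fun s => by
    rw [latticeMul_zak hd a (norm_classIndicator_le _)]
    have h := hasSum_inner_zak hd (norm_classIndicator_le s)
      (c' := fun u => freqChar (2 * r + 1) a.2 (latticeVec (2 * r + 1) (a.1 - u)) *
        classIndicator (-s) (u - a.1))
      (fun u => by rw [norm_mul, norm_freqChar, one_mul]; exact norm_classIndicator_le _ _)
      f (displace (2 * r + 1) a f)
    simp only [key] at h
    refine h.unique ?_
    split_ifs with hs
    · rw [inner_T_eq_displace]
      have h2 := (hasSum_inner_zakTerm_residue hd f (displace (2 * r + 1) a f) s).mul_left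
        (Complex.exp (Complex.I * ((Real.pi * ((toReal a).1 ⬝ᵥ (toReal a).2) : ℝ) : ℂ)) *
          Complex.exp (Complex.I *
            ((Real.pi * ((toReal a).1 ⬝ᵥ (toReal a).2) / (2 * r + 1 : ℕ) : ℝ) : ℂ)))
      rw [mul_left_comm, mul_assoc] at h2
      refine h2.congr_fun fun u => ?_
      split_ifs <;> simp
    · simp
  simp only [hval, Finset.sum_ite_eq', Finset.mem_univ, if_true]

/-- The integral against a character of the lattice of Fourier modes, as a functional on `L¹`. -/
def fourierFunctional {n : ℕ} (d : ℕ) (a : Phase ℤ n) :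
    Lp ℂ 1 ((volume : Measure (Phase ℝ n)).restrict (cell d n)) →L[ℂ] ℂ :=
  L1.integralCLM' ℂ ∘L latticeMul d 1 a

theorem fourierFunctional_apply {n : ℕ} (d : ℕ) (a : Phase ℤ n)
    (F : Lp ℂ 1 ((volume : Measure (Phase ℝ n)).restrict (cell d n))) :
    fourierFunctional d a F = ∫ η in cell d n, latticeChar d a η * F η := by
  have h : fourierFunctional d a F = ∫ η in cell d n, latticeMul d 1 a F η := by
    rw [← L1.integral_eq_integral, L1.integral_eq' ℂ]
    rfl
  rw [h]
  exact integral_congr_ae (coeFn_latticeMul d 1 a F)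

theorem integral_norm_sq_eq {X : Type} [MeasurableSpace X] {μ : Measure X} (F : Lp ℂ 2 μ) :
    Integrable (fun x => ‖F x‖ ^ 2) μ ∧ ∫ x, ‖F x‖ ^ 2 ∂μ = ‖F‖ ^ 2 := by
  refine ⟨(memLp_two_iff_integrable_sq_norm (Lp.aestronglyMeasurable F)).1 (Lp.memLp F), ?_⟩
  have h := congrArg RCLike.re (L2.inner_def (𝕜 := ℂ) F F)
  rw [← integral_re (L2.integrable_inner F F), inner_self_eq_norm_sq] at h
  rw [h]
  exact integral_congr_ae (Eventually.of_forall fun x => (inner_self_eq_norm_sq (𝕜 := ℂ) _).symm)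

theorem integral_norm_inner_le {X : Type} [MeasurableSpace X] {μ : Measure X} (F G : Lp ℂ 2 μ) :
    ∫ x, ‖⟪F x, G x⟫_ℂ‖ ∂μ ≤ ‖F‖ ^ 2 + ‖G‖ ^ 2 := by
  obtain ⟨hF, hF'⟩ := integral_norm_sq_eq F
  obtain ⟨hG, hG'⟩ := integral_norm_sq_eq G
  rw [← hF', ← hG', ← integral_add hF hG]
  refine integral_mono (L2.integrable_inner F G).norm (hF.add hG) fun x => ?_
  refine (norm_inner_le_norm _ _).trans ?_
  change ‖F x‖ * ‖G x‖ ≤ ‖F x‖ ^ 2 + ‖G x‖ ^ 2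
  nlinarith [sq_nonneg (‖F x‖ - ‖G x‖), sq_nonneg (‖F x‖ + ‖G x‖)]

/-- The function is `∑_s conj(Z_s f) Z_{-s} f`. Each of its terms has `L¹` norm at most `‖Z_s f‖² +
‖Z_{-s} f‖² = 2 (dℓ)ⁿ ‖f‖²`; the constant does not depend on `f`, which permits summation over the
vectors of a state. -/
theorem exists_wigner_of_vector {d : ℕ} (hd : Odd d) (n : ℕ) : ∃ C : ℝ, ∀ f : Hilb n,
    ∃ W : Lp ℂ 1 ((volume : Measure (Phase ℝ n)).restrict (cell d n)), ‖W‖ ≤ C * ‖f‖ ^ 2 ∧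
      ∀ a : Phase ℤ n, fourierFunctional d a W = ((d * ell d : ℝ) : ℂ) ^ n *
        (Complex.exp (Complex.I * ((Real.pi * ((toReal a).1 ⬝ᵥ (toReal a).2) : ℝ) : ℂ)) *
          ⟪f, T d (toReal a) f⟫_ℂ) := by
  have : NeZero d := ⟨hd.pos.ne'⟩
  refine ⟨∑ s : Fin n → ZMod d, 2 * (d * ell d) ^ n, fun f => ?_⟩
  have hint : ∀ s : Fin n → ZMod d, Integrable (fun η =>
      ⟪zak d (classIndicator s) f η, zak d (classIndicator (-s)) f η⟫_ℂ)
      (volume.restrict (cell d n)) := fun s => L2.integrable_inner _ _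
  refine ⟨∑ s : Fin n → ZMod d, (hint s).toL1 _, ?_, fun a => ?_⟩
  · rw [Finset.sum_mul]
    refine (norm_sum_le _ _).trans (Finset.sum_le_sum fun s _ => ?_)
    have hnorm : ∀ᵐ η ∂(volume.restrict (cell d n)), ‖(hint s).toL1 _ η‖ =
        ‖⟪zak d (classIndicator s) f η, zak d (classIndicator (-s)) f η⟫_ℂ‖ :=
      (hint s).coeFn_toL1.mono fun η h => by rw [h]
    rw [L1.norm_eq_integral_norm, integral_congr_ae hnorm]
    refine (integral_norm_inner_le _ _).trans (le_of_eq ?_)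
    rw [norm_sq_zak_classIndicator hd.pos, norm_sq_zak_classIndicator hd.pos]
    ring
  · rw [map_sum, ← sum_inner_zak hd]
    refine Finset.sum_congr rfl fun s _ => ?_
    rw [fourierFunctional_apply, L2.inner_def]
    refine integral_congr_ae ?_
    filter_upwards [(hint s).coeFn_toL1, coeFn_latticeMul d 2 a (zak d (classIndicator (-s)) f)]
      with η h1 h2
    rw [h1, h2, RCLike.inner_apply, RCLike.inner_apply]
    ring

/-! ### Fourier series of states -/

theorem hasWignerSeries_of_fourierFunctional {n d : ℕ} {ρ : Hilb n →L[ℂ] Hilb n}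
    (W : Lp ℂ 1 ((volume : Measure (Phase ℝ n)).restrict (cell d n)))
    (h : ∀ a : Phase ℤ n, fourierFunctional d a W = ((d * ell d : ℝ) : ℂ) ^ n *
      (Complex.exp (Complex.I * ((Real.pi * ((toReal a).1 ⬝ᵥ (toReal a).2) : ℝ) : ℂ)) *
        trace (ρ ∘L T d (toReal a)))) :
    HasWignerSeries d ρ
      fun η => ((d * ell d : ℝ) : ℂ) ^ n * (1 / (2 * (Real.pi : ℂ)) ^ n) * W η := by
  -- The Zak construction carries one factor `(dℓ)ⁿ`; the prefactor supplies the second one and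
  -- `(2π)⁻ⁿ`.
  refine ⟨(L1.integrable_coeFn W).const_mul _, fun a => ?_⟩
  have h1 := h a
  rw [fourierFunctional_apply] at h1
  have h2 : ∀ η, Complex.exp (-(Complex.I * ((ell d * symp (toReal a) η : ℝ) : ℂ))) *
      (((d * ell d : ℝ) : ℂ) ^ n * (1 / (2 * (Real.pi : ℂ)) ^ n) * W η) =
      ((d * ell d : ℝ) : ℂ) ^ n * (1 / (2 * (Real.pi : ℂ)) ^ n) * (latticeChar d a η * W η) :=
    fun η => by rw [latticeChar]; ring
  simp only [h2]
  rw [integral_const_mul, h1]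
  ring

/-- The functions of the vectors `v_j` are summable in `L¹` since `∑ ‖v_j‖² < ∞`, and Fourier
coefficients are continuous on `L¹`. -/
theorem IsState.exists_hasWignerSeries {d : ℕ} (hd : Odd d) {n : ℕ} {ρ : Hilb n →L[ℂ] Hilb n}
    (hρ : IsState ρ) : ∃ W, HasWignerSeries d ρ W := by
  obtain ⟨v, hv, hv'⟩ := hρ.exists_hasSum_rankOne
  obtain ⟨C, hC⟩ := exists_wigner_of_vector hd n
  choose W hW hW' using fun j => hC (v j)
  have hs : Summable W := Summable.of_norm_bounded (hv.mul_left C) hW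
  refine ⟨_, hasWignerSeries_of_fourierFunctional (∑' j, W j) fun a => ?_⟩
  refine (hs.hasSum.mapL (fourierFunctional d a)).unique ?_
  simp only [hW']
  exact ((hasSum_trace_comp hv hv' (T d (toReal a))).mul_left _).mul_left _

/-! ### Absolutely convergent Wigner series -/

theorem phaseCoeff_eq {n : ℕ} (d : ℕ) (η : Phase ℝ n) (a : Phase ℤ n) :
    phaseCoeff d η a = latticeChar d (-a) η *
      Complex.exp (Complex.I * ((Real.pi * ((toReal a).1 ⬝ᵥ (toReal a).2) : ℝ) : ℂ)) := by
  rw [phaseCoeff, latticeChar, ← Complex.exp_add]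
  congr 1
  have h : symp (toReal (-a)) η = -symp (toReal a) η := by
    have h1 : (toReal (-a)).1 = -(toReal a).1 := funext fun i => by simp [toReal]
    have h2 : (toReal (-a)).2 = -(toReal a).2 := funext fun i => by simp [toReal]
    rw [symp, symp, h1, h2, neg_dotProduct, neg_dotProduct]
    ring
  rw [h]
  push_cast
  ring

theorem latticeChar_add {n : ℕ} (d : ℕ) (a b : Phase ℤ n) (η : Phase ℝ n) :
    latticeChar d (a + b) η = latticeChar d a η * latticeChar d b η := by
  simp only [latticeChar_eq_freqChar, Prod.fst_add, Prod.snd_add, neg_add, freqChar_add_left]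
  ring

theorem integral_latticeChar {d : ℕ} (hd : 0 < d) {n : ℕ} (a : Phase ℤ n) :
    ∫ η in cell d n, latticeChar d a η =
      if a = 0 then ((d * ell d : ℝ) : ℂ) ^ (2 * n) else 0 := by
  simp only [latticeChar_eq_freqChar, mul_comm (freqChar d (-a.1) _)]
  rw [restrict_cell, integral_prod_mul (freqChar d a.2) (freqChar d (-a.1))]
  simp only [freqChar]
  rw [integral_box_char hd a.2, integral_box_char hd (-a.1)]
  by_cases h1 : a.1 = 0 <;> by_cases h2 : a.2 = 0 <;> simp [Prod.ext_iff, h1, h2, two_mul, pow_add]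

/-- Absolute convergence allows termwise integration, and orthogonality of the characters leaves the
single term `b = a`. -/
theorem HasConvergentWigner.hasWignerSeries {d : ℕ} (hd : 0 < d) {n : ℕ}
    {ρ : Hilb n →L[ℂ] Hilb n} (h : HasConvergentWigner d ρ) :
    HasWignerSeries d ρ fun η => 1 / (2 * (Real.pi : ℂ)) ^ n *
      ∑' a : Phase ℤ n, phaseCoeff d η a * trace (ρ ∘L T d (toReal a)) := by
  let e : Phase ℤ n → ℂ := fun a =>
    Complex.exp (Complex.I * ((Real.pi * ((toReal a).1 ⬝ᵥ (toReal a).2) : ℝ) : ℂ)) *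
      trace (ρ ∘L T d (toReal a))
  have he : Summable fun a => ‖e a‖ := by
    simpa only [e, norm_mul, norm_exp_I_mul, one_mul] using h.norm
  have hterm : ∀ η a, phaseCoeff d η a * trace (ρ ∘L T d (toReal a)) =
      latticeChar d (-a) η * e a := fun η a => by rw [phaseCoeff_eq, mul_assoc]
  have hnorm : ∀ η a, ‖latticeChar d (-a) η * e a‖ = ‖e a‖ := fun η a => by
    rw [norm_mul, norm_latticeChar, one_mul]
  simp only [hterm]
  have hcont : Continuous fun η : Phase ℝ n => ∑' a, latticeChar d (-a) η * e a :=
    continuous_tsum (fun a => (continuous_latticeChar d (-a)).mul continuous_const) he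
      fun a η => (hnorm η a).le
  have hint : IntegrableOn (fun η : Phase ℝ n => ∑' a, latticeChar d (-a) η * e a) (cell d n) :=
    Integrable.of_bound hcont.aestronglyMeasurable (∑' a, ‖e a‖) (Eventually.of_forall fun η => by
      refine (norm_tsum_le_tsum_norm (by simpa only [hnorm] using he)).trans ?_
      simp only [hnorm, le_refl])
  refine ⟨hint.const_mul _, fun a => ?_⟩
  have hF : ∀ b η, latticeChar d a η * (latticeChar d (-b) η * e b) =
      latticeChar d (a - b) η * e b := fun b η => by
    rw [← mul_assoc, sub_eq_add_neg, latticeChar_add]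
  have hFi : ∀ b, Integrable (fun η : Phase ℝ n => latticeChar d (a - b) η * e b)
      (volume.restrict (cell d n)) := fun b =>
    Integrable.of_bound ((continuous_latticeChar d (a - b)).mul
      continuous_const).aestronglyMeasurable ‖e b‖ (Eventually.of_forall fun η => by
        rw [norm_mul, norm_latticeChar, one_mul])
  have hFs : Summable fun b => ∫ η in cell d n, ‖latticeChar d (a - b) η * e b‖ := by
    simp only [norm_mul, norm_latticeChar, one_mul, integral_const, smul_eq_mul]
    exact he.mul_left _
  have hsum := hasSum_integral_of_summable_integral_norm hFi hFs
  have hsingle : HasSum (fun b => ∫ η in cell d n, latticeChar d (a - b) η * e b)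
      (((d * ell d : ℝ) : ℂ) ^ (2 * n) * e a) := by
    convert hasSum_single a fun b hb => ?_ using 1
    · rw [integral_mul_const, integral_latticeChar hd, if_pos (sub_self a)]
    · rw [integral_mul_const, integral_latticeChar hd, if_neg (sub_ne_zero.2 hb.symm), zero_mul]
  have hval := hsum.unique hsingle
  have h2 : ∀ η, Complex.exp (-(Complex.I * ((ell d * symp (toReal a) η : ℝ) : ℂ))) *
      (1 / (2 * (Real.pi : ℂ)) ^ n * ∑' b, latticeChar d (-b) η * e b) =
      1 / (2 * (Real.pi : ℂ)) ^ n * ∑' b, latticeChar d (a - b) η * e b := fun η => by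
    simp only [← hF]
    rw [tsum_mul_left, latticeChar]
    ring
  simp only [h2]
  rw [integral_const_mul, hval]
  ring

/-- Makes the case distinction in `wigner` harmless: states and their products may fall into
different cases, but their functions are always determined by the Fourier coefficients. -/
theorem hasWignerSeries_wigner {d : ℕ} (hd : 0 < d) {n : ℕ} {ρ : Hilb n →L[ℂ] Hilb n}
    (h : ∃ W, HasWignerSeries d ρ W) : HasWignerSeries d ρ (wigner d ρ) := by
  rw [wigner]
  split_ifs with hc
  · exact hc.hasWignerSeries hd
  · exact h.choose_spec

/-! ### Products of states -/

/-- Phase space is stored as positions and momenta, each split into two blocks; exchanging the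
middle factors sorts it by subsystem. -/
theorem measurePreserving_prodProdProdComm {α β γ δ : Type} [MeasureSpace α] [MeasureSpace β]
    [MeasureSpace γ] [MeasureSpace δ] [SigmaFinite (volume : Measure α)]
    [SigmaFinite (volume : Measure β)] [SigmaFinite (volume : Measure γ)]
    [SigmaFinite (volume : Measure δ)] :
    MeasurePreserving (fun x : (α × β) × γ × δ => ((x.1.1, x.2.1), (x.1.2, x.2.2)))
      volume volume := by
  have h1 : MeasurePreserving (MeasurableEquiv.prodAssoc : (α × β) × γ × δ ≃ᵐ α × β × γ × δ)
    volume volume := volume_preserving_prodAssoc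
  have h2 : MeasurePreserving (MeasurableEquiv.prodAssoc : (β × γ) × δ ≃ᵐ β × γ × δ)
    volume volume := volume_preserving_prodAssoc
  have h3 : MeasurePreserving (MeasurableEquiv.prodAssoc : (γ × β) × δ ≃ᵐ γ × β × δ)
    volume volume := volume_preserving_prodAssoc
  have h4 : MeasurePreserving (MeasurableEquiv.prodAssoc : (α × γ) × β × δ ≃ᵐ α × γ × β × δ)
    volume volume := volume_preserving_prodAssoc
  have hs : MeasurePreserving (Prod.swap : β × γ → γ × β) volume volume :=
    Measure.measurePreserving_swap
  have h5 : MeasurePreserving (Prod.map Prod.swap id : (β × γ) × δ → (γ × β) × δ)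
    volume volume := hs.prod (MeasurePreserving.id volume)
  have h6 := (MeasurePreserving.id (volume : Measure α)).prod ((h3.comp h5).comp (h2.symm _))
  exact ((h4.symm _).comp h6).comp h1

theorem measurePreserving_modes (m k : ℕ) : MeasurePreserving
    (fun η : Phase ℝ (m + k) => (fstModes η, sndModes η)) volume volume :=
  measurePreserving_prodProdProdComm.comp ((measurePreserving_split m k).prod
    (measurePreserving_split m k))

theorem measurableEmbedding_modes (m k : ℕ) : MeasurableEmbedding
    (fun η : Phase ℝ (m + k) => (fstModes η, sndModes η)) :=
  (measurePreserving_modes m k).measurable.measurableEmbedding (modesEquiv ℝ m k).injective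

theorem preimage_cell (d m k : ℕ) : (fun η : Phase ℝ (m + k) => (fstModes η, sndModes η)) ⁻¹'
    (cell d m ×ˢ cell d k) = cell d (m + k) := by
  ext η
  simp only [Set.mem_preimage, Set.mem_prod, cell, Set.mem_ofPred_eq, fstModes, sndModes, left,
    right, Fin.forall_fin_add]
  tauto

theorem measurePreserving_modes_cell (d m k : ℕ) : MeasurePreserving
    (fun η : Phase ℝ (m + k) => (fstModes η, sndModes η)) (volume.restrict (cell d (m + k)))
    ((volume.restrict (cell d m)).prod (volume.restrict (cell d k))) := by
  rw [Measure.prod_restrict, ← preimage_cell]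
  exact (measurePreserving_modes m k).restrict_preimage_emb (measurableEmbedding_modes m k) _

/-- Fubini after sorting by subsystem. No integrability or measurability of `F` and `G` is needed,
because the change of variables is a measurable embedding. -/
theorem integral_cell_mul {E : Type} [RCLike E] (d m k : ℕ) (F : Phase ℝ m → E)
    (G : Phase ℝ k → E) : ∫ η in cell d (m + k), F (fstModes η) * G (sndModes η) =
      (∫ η in cell d m, F η) * ∫ η in cell d k, G η := by
  rw [← integral_prod_mul]
  exact (measurePreserving_modes_cell d m k).integral_comp (measurableEmbedding_modes m k)
    fun p => F p.1 * G p.2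

theorem latticeChar_split {m k : ℕ} (d : ℕ) (a : Phase ℤ (m + k)) (η : Phase ℝ (m + k)) :
    latticeChar d a η =
      latticeChar d (fstModes a) (fstModes η) * latticeChar d (sndModes a) (sndModes η) := by
  rw [latticeChar, latticeChar, latticeChar, ← Complex.exp_add, symp_split]
  congr 1
  change -(Complex.I * ((ell d * (symp (toReal (fstModes a)) (fstModes η) +
    symp (toReal (sndModes a)) (sndModes η)) : ℝ) : ℂ)) = _
  push_cast
  ring

theorem HasWignerSeries.tensor {d m k : ℕ} {ρ : Hilb m →L[ℂ] Hilb m} {σ : Hilb k →L[ℂ] Hilb k}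
    (hρ : IsState ρ) (hσ : IsState σ) {W : Phase ℝ m → ℂ} {V : Phase ℝ k → ℂ}
    (hW : HasWignerSeries d ρ W) (hV : HasWignerSeries d σ V) :
    HasWignerSeries d (tensorOp ρ σ) fun η => W (fstModes η) * V (sndModes η) := by
  refine ⟨((measurePreserving_modes_cell d m k).integrable_comp_emb
    (measurableEmbedding_modes m k)).2 (hW.1.mul_prod hV.1), fun a => ?_⟩
  have h : ∀ η : Phase ℝ (m + k),
      Complex.exp (-(Complex.I * ((ell d * symp (toReal a) η : ℝ) : ℂ))) *
        (W (fstModes η) * V (sndModes η)) =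
      (fun η => latticeChar d (fstModes a) η * W η) (fstModes η) *
        (fun η => latticeChar d (sndModes a) η * V η) (sndModes η) := fun η => by
    change latticeChar d a η * _ = _
    rw [latticeChar_split]
    ring
  have h1 := hW.2 (fstModes a)
  have h2 := hV.2 (sndModes a)
  have h3 : (toReal a).1 ⬝ᵥ (toReal a).2 =
      (toReal (fstModes a)).1 ⬝ᵥ (toReal (fstModes a)).2 +
        (toReal (sndModes a)).1 ⬝ᵥ (toReal (sndModes a)).2 := dotProduct_split _ _
  refine ((integral_congr_ae (Eventually.of_forall h)).trans
    (integral_cell_mul d m k (fun η => latticeChar d (fstModes a) η * W η)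
      fun η => latticeChar d (sndModes a) η * V η)).trans ?_
  refine (congrArg₂ (· * ·) h1 h2).trans ?_
  rw [trace_tensorOp_T hρ hσ, h3, mul_add Real.pi, Complex.ofReal_add, mul_add Complex.I,
    Complex.exp_add, mul_add 2 m k, pow_add, pow_add, ← one_div_mul_one_div]
  ring

theorem HasConvergentWigner.tensor {d m k : ℕ} {ρ : Hilb m →L[ℂ] Hilb m}
    {σ : Hilb k →L[ℂ] Hilb k} (hρ : IsState ρ) (hσ : IsState σ) (h : HasConvergentWigner d ρ)
    (h' : HasConvergentWigner d σ) : HasConvergentWigner d (tensorOp ρ σ) := by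
  rw [HasConvergentWigner]
  simp only [trace_tensorOp_T hρ hσ]
  exact (summable_modes_mul h h' :)

theorem wigner_tensorOp {d m k : ℕ} {ρ : Hilb m →L[ℂ] Hilb m} {σ : Hilb k →L[ℂ] Hilb k}
    (hρ : IsState ρ) (hσ : IsState σ) (h : HasConvergentWigner d ρ) (h' : HasConvergentWigner d σ)
    (η : Phase ℝ (m + k)) :
    wigner d (tensorOp ρ σ) η = wigner d ρ (fstModes η) * wigner d σ (sndModes η) := by
  rw [wigner, wigner, wigner, if_pos (h.tensor hρ hσ h'), if_pos h, if_pos h']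
  simp only [trace_tensorOp_T hρ hσ]
  exact (phaseSum_split d η h h' :)

/-- Both sides are integrable functions with the same Fourier coefficients, so uniqueness applies.
-/
theorem wigner_tensorOp_ae {d : ℕ} (hd : Odd d) {m k : ℕ} {ρ : Hilb m →L[ℂ] Hilb m}
    {σ : Hilb k →L[ℂ] Hilb k} (hρ : IsState ρ) (hσ : IsState σ) :
    ∀ᵐ η ∂(volume.restrict (cell d (m + k))),
      wigner d (tensorOp ρ σ) η = wigner d ρ (fstModes η) * wigner d σ (sndModes η) := by
  have h := (hasWignerSeries_wigner hd.pos (hρ.exists_hasWignerSeries hd)).tensor hρ hσ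
    (hasWignerSeries_wigner hd.pos (hσ.exists_hasWignerSeries hd))
  exact (hasWignerSeries_wigner hd.pos ⟨_, h⟩).ae_eq hd.pos h

theorem negativity_tensorOp {d : ℕ} (hd : Odd d) {m k : ℕ} {ρ : Hilb m →L[ℂ] Hilb m}
    {σ : Hilb k →L[ℂ] Hilb k} (hρ : IsState ρ) (hσ : IsState σ) :
    negativity d (tensorOp ρ σ) = negativity d ρ * negativity d σ := by
  rw [negativity, negativity, negativity, ← integral_cell_mul]
  refine integral_congr_ae ?_
  filter_upwards [wigner_tensorOp_ae hd hρ hσ] with η hη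
  rw [hη, norm_mul]

end ZakGross

end

open ZakGross in
theorem mainTheorem5 (d : ℕ) (hd : Odd d) (m k : ℕ) :
    -- the phase-point operators are well defined on Schwartz functions
    (∀ (n : ℕ) (φ ψ : 𝓢(Fin n → ℝ, ℂ)), InFormDomain d (φ.toLp 2) (ψ.toLp 2)) ∧
    -- `A_η = A_{η⁽¹⁾} ⊗ A_{η⁽²⁾}` : matrix elements between product vectors
    (∀ (f₁ g₁ : Hilb m) (f₂ g₂ : Hilb k), InFormDomain d f₁ g₁ → InFormDomain d f₂ g₂ →
      InFormDomain d (tensorVec f₁ f₂) (tensorVec g₁ g₂) ∧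
      ∀ η : Phase ℝ (m + k),
        phasePoint d η (tensorVec f₁ f₂) (tensorVec g₁ g₂) =
          phasePoint d (fstModes η) f₁ g₁ * phasePoint d (sndModes η) f₂ g₂) ∧
    -- `A_η = A_{η⁽¹⁾} ⊗ A_{η⁽²⁾}` : all matrix elements, as limits of tensor products of truncations
    (∀ F G : Hilb (m + k), InFormDomain d F G → ∀ η : Phase ℝ (m + k),
      Tendsto (fun S : Finset (Phase ℤ m) × Finset (Phase ℤ k) =>
          ⟪F, tensorOp (phasePointTrunc d (fstModes η) S.1)
            (phasePointTrunc d (sndModes η) S.2) G⟫_ℂ)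
        atTop (𝓝 (phasePoint d η F G))) ∧
    ∀ (ρ : Hilb m →L[ℂ] Hilb m) (σ : Hilb k →L[ℂ] Hilb k), IsState ρ → IsState σ →
      -- `W_{ρ ⊗ σ}(η) = W_ρ(η⁽¹⁾) W_σ(η⁽²⁾)`, at every `η` if the defining series converge
      (HasConvergentWigner d ρ → HasConvergentWigner d σ →
        HasConvergentWigner d (tensorOp ρ σ) ∧
        ∀ η : Phase ℝ (m + k),
          wigner d (tensorOp ρ σ) η = wigner d ρ (fstModes η) * wigner d σ (sndModes η)) ∧
      -- and for all states at almost every `η`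
      (∀ᵐ η ∂(volume.restrict (cell d (m + k))),
        wigner d (tensorOp ρ σ) η = wigner d ρ (fstModes η) * wigner d σ (sndModes η)) ∧
      -- the negativity is multiplicative
      negativity d (tensorOp ρ σ) = negativity d ρ * negativity d σ := by
  refine ⟨fun n φ ψ => inFormDomain_schwartz hd.pos φ ψ, fun f₁ g₁ f₂ g₂ h₁ h₂ =>
    ⟨inFormDomain_tensorVec h₁ h₂, phasePoint_tensorVec h₁ h₂⟩,
    fun F G h η => tendsto_inner_tensorOp_phasePointTrunc h η, fun ρ σ hρ hσ =>
    ⟨fun h h' => ⟨h.tensor hρ hσ h', wigner_tensorOp hρ hσ h h'⟩,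
      wigner_tensorOp_ae hd hρ hσ, negativity_tensorOp hd hρ hσ⟩⟩
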